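/- Let $l\ge 1$, let $N_1,\dots,N_l\ge 1$ be integers, $n=\min_i N_i$ and $J=\{j : N_j=n\}$. Let $a_{ki}\ge 1$ ($1\le k\le n$, $1\le i\le l$) be integers with $\sum_{k=1}^n a_{ki}=N_i+1$ for all $i$. (These are the multidegrees of $n$ ample divisors $D_k=\sum_i a_{ki}H_i$ on $\mathbb P^{N_1}\times\cdots\times\mathbb P^{N_l}$ with $\sum_k D_k=-K$.) For $i\neq j$ let $b_{ij}$ be the coefficient of $H_iH_j^{n-1}$ in $\prod_{k=1}^n\sum_i a_{ki}H_i$, and let $B$ be the symmetric real $l\times l$ matrix with $B_{ii}=1$ and, for $i\ne j$, $B_{ij}=-b_{ij}/2$ if $j\in J$, $B_{ij}=-b_{ji}/2$ if $i\in J$ (the two agree if $i,j\in J$), and $B_{ij}=-N_l$ if $i,j\notin J$. Let $W=\langle s_1,\dots,s_l\mid s_i^2=1\rangle$ be the universal Coxeter group and $W_J=\langle s_j : j\in J\rangle$. Let $V$ be the real vector space with basis $\alpha_1,\dots,\alpha_l$ and bilinear form $\mathcal B(\alpha_i,\alpha_j)=B_{ij}$. Let $\rho:W\to GL(V)$ be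 the representation $\rho(s_i)(w)=w-2\mathcal B(w,\alpha_i)\alpha_i$, and $\rho^*$ the dual representation on $V^*$. Let $c_1,\dots,c_l\in V^*$ be the basis dual to $\alpha_1,\dots,\alpha_l$, let $D=\{f\in V^* : f(\alpha_i)\ge 0\ \text{for all } i\}$ and $T_J=\bigcup_{w\in W_J}\rho^*(w)(D)$. Suppose that $W_J$ is Lorentzian, that is, that the submatrix $B_J=(B_{ij})_{i,j\in J}$ has signature $(|J|-1,1)$. If $n\ge 2$, then for all $i\ne j$ in $J$ the operator $\rho^*(s_is_j)$ has a unique eigenvalue $\lambda>1$, and this eigenvalue has an eigenvector in $\overline{T_J}$; let $v_{ij}$ be any such eigenvector. If $n=1$, put $v_{ij}=0$. Then the boundary of $\overline{T_J}$ is the closure of the union of the following sets: 1. the $W_J$-orbits of the faces $\{\sum_{k\ne i}a_kc_k : a_k\ge 0\}$, for $i\notin J$; 2. the $W_J$-orbits of the cones $\{t\,v_{ij}+\sum_{k\ne i,j}a_kc_k : t\ge 0,\ a_k\ge 0\}$, for $i,j\in J$, $i\ne j$. If there are vectors $c_i\in V$ with $\mathcal B(c_i,\alpha_j)=\delta_{ij}$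 (that is, if $\mathcal B$ is nondegenerate), then the same holds in $V$, with $\rho$ in place of $\rho^*$, these $c_i$, and $D=\{w\in V:\mathcal B(w,\alpha_i)\ge 0\ \text{for all } i\}$. -/

import Mathlib

/-! Boundary of the subcone `T_J` of the Tits cone of a universal Coxeter group. -/

noncomputable section

namespace MovCone

/-! ### The universal Coxeter group and its geometric representation -/

/-- The Coxeter matrix with `m_ii = 1` and `m_ij = ∞` for `i ≠ j` (Mathlib encodes `∞` by `0`). -/
def universalMatrix (l : ℕ) : CoxeterMatrix (Fin l) where
  M := Matrix.of fun i j => if i = j then 1 else 0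
  isSymm := by
    ext i j
    simp [Matrix.transpose_apply, eq_comm]
  diagonal := by simp
  off_diagonal := by
    intro i j h
    simp [h]

/-- The universal Coxeter group `W = ⟨s_1, …, s_l ∣ s_i² = 1⟩`. -/
abbrev W (l : ℕ) : Type := (universalMatrix l).Group

/-- The simple generators `s_i` of `W`. -/
abbrev s {l : ℕ} (i : Fin l) : W l := (universalMatrix l).simple i

/-- The subgroup `W_J` generated by the `s_j`, `j ∈ J`. -/
def parabolic {l : ℕ} (J : Finset (Fin l)) : Subgroup (W l) :=
  Subgroup.closure {g | ∃ j ∈ J, g = s j}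

/-- The space `V` with basis `α_1, …, α_l`. -/
abbrev V (l : ℕ) : Type := Fin l → ℝ

/-- The simple root `α_i`. -/
def simpleRoot {l : ℕ} (i : Fin l) : V l := Pi.single i 1

/-- The bilinear form on `V` with `𝓑(α_i, α_j) = B_ij`. -/
def form {l : ℕ} (B : Matrix (Fin l) (Fin l) ℝ) : LinearMap.BilinForm ℝ (V l) :=
  Matrix.toBilin' B

/-- `σ_v(w) = w - 2 (𝓑(w, v) / 𝓑(v, v)) v`. -/
def sigma {l : ℕ} (B : Matrix (Fin l) (Fin l) ℝ) (v : V l) : V l →ₗ[ℝ] V l :=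
  LinearMap.id - (2 / form B v v) • ((form B).flip v).smulRight v

theorem sigma_apply {l : ℕ} (B : Matrix (Fin l) (Fin l) ℝ) (v w : V l) :
    sigma B v w = w - (2 * (form B w v / form B v v)) • v := by
  have h : sigma B v w = w - (2 / form B v v) • (form B w v • v) := rfl
  rw [h, smul_smul]
  congr 2
  ring

theorem sigma_mul_self {l : ℕ} (B : Matrix (Fin l) (Fin l) ℝ) (v : V l) :
    sigma B v * sigma B v = 1 := by
  refine LinearMap.ext fun w => ?_
  rw [Module.End.mul_apply, Module.End.one_apply, sigma_apply B v w, map_sub, map_smul,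
    sigma_apply B v w, sigma_apply B v v]
  by_cases h : form B v v = 0
  · simp [h]
  · rw [div_self h]
    module

theorem sigma_isLiftable {l : ℕ} (B : Matrix (Fin l) (Fin l) ℝ) :
    (universalMatrix l).IsLiftable (fun i => sigma B (simpleRoot i)) := by
  intro i j
  by_cases h : i = j
  · subst h
    rw [sigma_mul_self, one_pow]
  · have : (universalMatrix l) i j = 0 := by
      change (if i = j then 1 else 0) = 0
      simp [h]
    rw [this, pow_zero]

/-- The geometric representation `ρ : W → GL(V)`, `s_i ↦ σ_{α_i}`. -/
def geomRep {l : ℕ} (B : Matrix (Fin l) (Fin l) ℝ) : Representation ℝ (W l) (V l) :=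
  (universalMatrix l).toCoxeterSystem.lift ⟨fun i => sigma B (simpleRoot i), sigma_isLiftable B⟩

theorem geomRep_s {l : ℕ} (B : Matrix (Fin l) (Fin l) ℝ) (i : Fin l) :
    geomRep B (s i) = sigma B (simpleRoot i) := by
  have h := (universalMatrix l).toCoxeterSystem.lift_apply_simple (sigma_isLiftable B) i
  rwa [CoxeterMatrix.toCoxeterSystem_simple] at h

/-- The subgroup `W_J` is Lorentzian: the submatrix `B_J` with rows and columns in `J` has
signature `(|J| - 1, 1)`. -/
def IsLorentzian {l : ℕ} (B : Matrix (Fin l) (Fin l) ℝ) (J : Finset (Fin l)) : Prop :=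
  let BJ : Matrix J J ℝ := B.submatrix Subtype.val Subtype.val
  let Q : QuadraticForm ℝ (J → ℝ) := (Matrix.toBilin' BJ).toQuadraticMap
  sigPos Q + 1 = J.card ∧ sigNeg Q = 1

/-! ### The dual space and the fundamental chambers -/

/-- The usual topology of the finite-dimensional space `V^*` (pointwise convergence). -/
instance dualTopology (l : ℕ) : TopologicalSpace (Module.Dual ℝ (V l)) :=
  TopologicalSpace.induced (fun f v => f v) inferInstance

/-- The fundamental chamber in `V^*`: the `f` with `f(α_i) ≥ 0` for all `i`. -/
def dualChamber (l : ℕ) : Set (Module.Dual ℝ (V l)) :=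
  {f | ∀ i, 0 ≤ f (simpleRoot i)}

/-- The basis of `V^*` dual to the simple roots: `c_i(α_j) = δ_ij`. -/
def dualRoot {l : ℕ} (i : Fin l) : Module.Dual ℝ (V l) := LinearMap.proj i

/-- The fundamental chamber in `V`: the `w` with `𝓑(w, α_i) ≥ 0` for all `i`. -/
def chamber {l : ℕ} (B : Matrix (Fin l) (Fin l) ℝ) : Set (V l) :=
  {w | ∀ i, 0 ≤ form B w (simpleRoot i)}

/-! ### Orbits and cones, in an arbitrary representation `r` of `W` -/

section Cones

variable {l : ℕ} {U : Type} [AddCommGroup U] [Module ℝ U]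

/-- The union of the translates `r(w)(A)`, `w ∈ W_J`. For `A = D` this is `T_J`. -/
def orbit (r : Representation ℝ (W l) U) (J : Finset (Fin l)) (A : Set U) : Set U :=
  ⋃ w ∈ parabolic J, r w '' A

/-- The face `{∑_{k ≠ i} a_k c_k ∣ a_k ≥ 0}`. -/
def face (c : Fin l → U) (i : Fin l) : Set U :=
  {x | ∃ a : Fin l → ℝ, (∀ k, 0 ≤ a k) ∧ x = ∑ k ∈ Finset.univ \ {i}, a k • c k}

/-- The cone `{t v + ∑_{k ≠ i, j} a_k c_k ∣ t ≥ 0, a_k ≥ 0}`. -/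
def cone (c : Fin l → U) (i j : Fin l) (v : U) : Set U :=
  {x | ∃ (t : ℝ) (a : Fin l → ℝ), 0 ≤ t ∧ (∀ k, 0 ≤ a k) ∧
    x = t • v + ∑ k ∈ Finset.univ \ {i, j}, a k • c k}

/-- `v` is an eigenvector of `r(s_i s_j)` for an eigenvalue `λ > 1`, with its sign chosen such that
`v` lies in the closure of the cone `T`. -/
def IsExpandingVector [TopologicalSpace U] (r : Representation ℝ (W l) U) (T : Set U)
    (i j : Fin l) (v : U) : Prop :=
  (∃ lam : ℝ, 1 < lam ∧ Module.End.HasEigenvector (r (s i * s j)) lam v) ∧ v ∈ closure T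

end Cones

/-! ### The matrix attached to a complete intersection in a product of projective spaces

`X ⊆ ℙ^{N_1} × ⋯ × ℙ^{N_l}` is the intersection of `n` divisors of classes
`D_k = ∑_i a_{k i} H_i`. -/

/-- `J = {j ∣ N_j = n}`. -/
def minIndices {l : ℕ} (N : Fin l → ℕ) (n : ℕ) : Finset (Fin l) :=
  Finset.univ.filter fun j => N j = n

/-- `b_ij`: the coefficient of `H_i H_j^{n-1}` in the class `[X] = ∏_k ∑_i a_{k i} H_i`.
(For `i ≠ j`, `N_i ≥ 1` and `N_j ≥ n - 1` this monomial is not killed by the relations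
`H_i^{N_i+1} = 0` of the Chow ring, so the coefficient may be read off in the polynomial ring.) -/
def coeffB {l n : ℕ} (a : Fin n → Fin l → ℕ) (i j : Fin l) : ℕ :=
  MvPolynomial.coeff (Finsupp.single i 1 + Finsupp.single j (n - 1))
    (∏ k, ∑ m, MvPolynomial.C (a k m) * MvPolynomial.X m : MvPolynomial (Fin l) ℕ)

/-- The matrix `B` attached to `X`. The entries with `i, j ∉ J` are `-N_l` (last factor). -/
def ciMatrix {l n : ℕ} (N : Fin l → ℕ) (a : Fin n → Fin l → ℕ) : Matrix (Fin l) (Fin l) ℝ :=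
  Matrix.of fun i j =>
    if i = j then 1
    else if j ∈ minIndices N n then -(coeffB a i j : ℝ) / 2
    else if i ∈ minIndices N n then -(coeffB a j i : ℝ) / 2
    else -(N ⟨l - 1, Nat.sub_lt (Nat.lt_of_le_of_lt (Nat.zero_le _) i.isLt) Nat.one_pos⟩ : ℝ)

end MovCone

end

/-!
Why the boundary of `T_J` has this description.

Everything is done in the coordinates `f ↦ (f(α_i))_i`, in which the chamber is the nonnegative
orthant and `s_j` acts by `f ↦ f - 2 f_j B_j` (`IsContragredient`); both `V^*` and, if the `c_i`
exist, `V` are linearly homeomorphic to this model (`IsLorentzianDatum.boundary`). What is needed of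
`B` is collected in `IsLorentzianDatum`: off-diagonal entries at most `-1`, integrality of `2B`, and
an explicit Lorentzian structure on the `α_j`, `j ∈ J`. It is verified in
`isLorentzianDatum_ciMatrix`: for `j ∈ J` the degrees `a_kj` are all `1` except for one `2`, so that
`B_J` is a multiple of the identity, minus a matrix of rank one, plus a Gram matrix.

*The pieces lie in the boundary.* Following a vector along a word whose adjacent letters differ
(`word_dotProduct_nonneg`) shows that `T_J` is nonnegative on the roots `α_i`, `i ∉ J`, on
`∑_{j ∈ J} α_j`, and on the isotropic vectors `z = μ α_i + α_j`, `i, j ∈ J`. The face of `i ∉ J`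
lies in the hyperplane of `α_i`. An expanding vector `v_ij` is a positive multiple of `-𝓑(·, z)`
(`eigen_classification`), so the cone of `i, j` lies in the hyperplane of `z`; and it lies in the
closure of `T_J`, as the limit of translates of chamber points by `(s_i s_j)^m`.

*The pieces are dense in the boundary.* Let `f` be a boundary point, the limit of `w_m y_m` with
`w_m ∈ W_J` and `y_m = ∑_k y_{m,k} c_k` in the chamber. Since the closure of `T_J` contains no line
(`exists_norm_le`), the terms `y_{m,k} w_m c_k` converge along a subsequence, to `E_k` say; since
the `w_m c_k` are nonzero lattice vectors, so do the `y_{m,k}`, and `w_m c_k` is eventually constant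
unless `k` lies in `M = {k | lim y_{m,k} = 0}`. After a translation, `w_m` fixes `c_k` for `k ∉ M`.
If `M` contains some `k ∉ J`, then dropping the `k`-th term approximates `f` by points of faces.
Otherwise invariance of the Lorentzian form under `w_m` forces the `E_j`, `j ∈ M`, to be of the form
`𝓑(·, x_j)` with `x_j` in the span of the `α_k`, `k ∈ M`, isotropic and mutually orthogonal, hence
parallel. If `|M| ≤ 1`, they vanish and `f` is interior. If `|M| = 2`, an isotropic vector in the
span of two roots is all that is left, and `f` lies on a cone. If `|M| ≥ 3`, the `E_j` are multiples
of a single one of them, so only one of the terms with `k ∈ M` is needed to approximate `f`, and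
the approximating points lie on translates of the cones of two other elements of `M`
(`mem_closure_of_limit`).
-/

namespace MovCone

open Filter Topology

section Boundary

/-! ### Words and the contragredient representation in coordinates -/

/-- The properties of the Gram matrix `B` and of the index set `J` on which the description of the
boundary rests. The conditions `pos` and `neg` say that `B_J` is Lorentzian in a specific way: it
is positive definite on the hyperplane `∑ x_i = 0`, and `∑_{k ∈ J} α_k` pairs negatively with every
`α_j`, `j ∈ J`. By `int`, the group preserves a lattice. -/
structure IsLorentzianDatum {l : ℕ} (B : Matrix (Fin l) (Fin l) ℝ) (J : Finset (Fin l)) :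
    Prop where
  symm : ∀ i j, B i j = B j i
  diag : ∀ i, B i i = 1
  le_neg_one : ∀ i j, i ≠ j → B i j ≤ -1
  int : ∀ i j, ∃ z : ℤ, 2 * B i j = z
  pos : ∀ x : V l, (∀ i ∉ J, x i = 0) → ∑ i, x i = 0 → x ⬝ᵥ B.mulVec x ≤ 0 → x = 0
  neg : ∀ j ∈ J, ∑ k ∈ J, B j k < 0
  nonempty : J.Nonempty

/-- A representation on `ℝ^l` that is the dual of the geometric one, where `f ∈ V^*` is identified
with the vector of its values `f(α_i)`. -/
def IsContragredient {l : ℕ} (B : Matrix (Fin l) (Fin l) ℝ) (r : Representation ℝ (W l) (V l)) :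
    Prop :=
  ∀ j f, r (s j) f = f - (2 * f j) • B j

/-- The nonnegative orthant: the fundamental chamber in the coordinates `f(α_i)`. -/
def orthant (l : ℕ) : Set (V l) := {f | ∀ i, 0 ≤ f i}

variable {l : ℕ} {B : Matrix (Fin l) (Fin l) ℝ} {J : Finset (Fin l)}
  {r : Representation ℝ (W l) (V l)}

theorem s_mul_s (j : Fin l) : (s j : W l) * s j = 1 := by
  have h := (universalMatrix l).toCoxeterSystem.simple_mul_simple_self j
  rwa [CoxeterMatrix.toCoxeterSystem_simple] at h

theorem s_inv (j : Fin l) : (s j : W l)⁻¹ = s j :=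
  inv_eq_of_mul_eq_one_left (s_mul_s j)

theorem s_mem_parabolic {j : Fin l} (hj : j ∈ J) : s j ∈ parabolic J :=
  Subgroup.subset_closure ⟨j, hj, rfl⟩

theorem parabolic_induction {p : W l → Prop} (one : p 1)
    (mul : ∀ j ∈ J, ∀ w ∈ parabolic J, p w → p (s j * w)) {w : W l} (hw : w ∈ parabolic J) :
    p w := by
  refine Subgroup.closure_induction_left (p := fun w _ => p w) one ?_ ?_ hw
  · rintro x ⟨j, hj, rfl⟩ y hy h
    exact mul j hj y hy h
  · rintro x ⟨j, hj, rfl⟩ y hy h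
    rw [s_inv]
    exact mul j hj y hy h

/-- Every element of `W_J` is the product of a word in which adjacent letters differ. -/
theorem exists_word {w : W l} (hw : w ∈ parabolic J) :
    ∃ L : List (Fin l), (∀ j ∈ L, j ∈ J) ∧ L.IsChain (· ≠ ·) ∧ w = (L.map s).prod := by
  refine parabolic_induction (p := fun w => ∃ L : List (Fin l), (∀ j ∈ L, j ∈ J) ∧
    L.IsChain (· ≠ ·) ∧ w = (L.map s).prod) ⟨[], by simp, by simp, by simp⟩ ?_ hw
  rintro j hj w - ⟨L, hL, hc, rfl⟩
  rcases L with _ | ⟨k, L⟩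
  · exact ⟨[j], by simpa using hj, by simp, by simp⟩
  · by_cases h : j = k
    · subst h
      refine ⟨L, fun i hi => hL i (List.mem_cons_of_mem _ hi), hc.tail, ?_⟩
      rw [List.map_cons, List.prod_cons, ← mul_assoc, s_mul_s, one_mul]
    · refine ⟨j :: k :: L, ?_, List.isChain_cons_cons.2 ⟨h, hc⟩, by simp⟩
      intro i hi
      rcases List.mem_cons.1 hi with rfl | hi
      exacts [hj, hL i hi]

theorem apply_s_apply_s (j : Fin l) (f : V l) : r (s j) (r (s j) f) = f := by
  rw [← Module.End.mul_apply, ← map_mul, s_mul_s, map_one, Module.End.one_apply]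

namespace IsContragredient

theorem apply (hr : IsContragredient B r) (j : Fin l) (f : V l) (i : Fin l) :
    r (s j) f i = f i - 2 * f j * B j i := by
  rw [hr]; simp

theorem apply_eq_self (hr : IsContragredient B r) {j : Fin l} {f : V l} (h : f j = 0) :
    r (s j) f = f := by
  rw [hr]; simp [h]

theorem eq_self_of_mem (hr : IsContragredient B r) {f : V l} (h : ∀ j ∈ J, f j = 0) {w : W l}
    (hw : w ∈ parabolic J) : r w f = f := by
  refine parabolic_induction (p := fun w => r w f = f) (by simp) ?_ hw
  intro j hj w _ ih
  rw [map_mul, Module.End.mul_apply, ih, hr.apply_eq_self (h j hj)]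

end IsContragredient

/-- The reflection `σ_{α_j}` of `V`, to which `r (s j)` is adjoint. -/
def simpleReflection (B : Matrix (Fin l) (Fin l) ℝ) (j : Fin l) (x : V l) : V l :=
  x - (2 * (B j ⬝ᵥ x)) • Pi.single j 1

theorem IsContragredient.dotProduct (hr : IsContragredient B r) (j : Fin l) (f x : V l) :
    r (s j) f ⬝ᵥ x = f ⬝ᵥ simpleReflection B j x := by
  rw [hr, simpleReflection, sub_dotProduct, dotProduct_sub, smul_dotProduct, dotProduct_smul,
    dotProduct_single]
  simp only [smul_eq_mul]
  ring

theorem row_dotProduct_simpleReflection (j m : Fin l) (x : V l) :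
    B m ⬝ᵥ simpleReflection B j x = B m ⬝ᵥ x - 2 * (B j ⬝ᵥ x) * B m j := by
  simp [simpleReflection, dotProduct_sub]

/-- The positive vectors reached by words whose first letter is `k`: those that `σ_{α_j}`, `j ≠ k`,
moves further up. Adjacent letters of the words being different,
`simpleReflection_mem_ascentCone` lets one follow a vector along a whole word. -/
def ascentCone (B : Matrix (Fin l) (Fin l) ℝ) (k : Fin l) : Set (V l) :=
  {x | (∀ i, 0 ≤ x i) ∧ ∀ m ≠ k, B m ⬝ᵥ x ≤ 0 ∧ B k ⬝ᵥ x ≤ -(B m ⬝ᵥ x)}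

theorem IsLorentzianDatum.simpleReflection_mem_ascentCone (hB : IsLorentzianDatum B J) {j k : Fin l}
    (hjk : j ≠ k) {x : V l} (hx : x ∈ ascentCone B k) :
    simpleReflection B j x ∈ ascentCone B j := by
  obtain ⟨h0, h⟩ := hx
  obtain ⟨h1, h2⟩ := h j hjk
  refine ⟨fun i => ?_, fun m hm => ?_⟩
  · by_cases hi : i = j
    · subst hi
      simp only [simpleReflection, Pi.sub_apply, Pi.smul_apply, Pi.single_eq_same, smul_eq_mul,
        mul_one]
      linarith [h0 i]
    · simpa [simpleReflection, hi] using h0 i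
  · rw [row_dotProduct_simpleReflection, row_dotProduct_simpleReflection, hB.diag]
    have hmj := hB.le_neg_one m j hm
    have hp : (B j ⬝ᵥ x) * (B m j + 1) ≥ 0 := mul_nonneg_of_nonpos_of_nonpos h1 (by linarith)
    by_cases hmk : m = k
    · subst hmk
      constructor <;> linarith
    · have := (h m hmk).1
      constructor <;> linarith

/-- A chamber point stays nonnegative on a vector of `ascentCone B k` under words not beginning
with `k`. -/
theorem IsLorentzianDatum.word_dotProduct_nonneg (hB : IsLorentzianDatum B J)
    (hr : IsContragredient B r) {d : V l} (hd : d ∈ orthant l) (L : List (Fin l)) :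
    L.IsChain (· ≠ ·) → ∀ k, (∀ j ∈ L.head?, j ≠ k) → ∀ x ∈ ascentCone B k,
      0 ≤ r (L.map s).prod d ⬝ᵥ x := by
  induction L with
  | nil =>
    intro _ k _ x hx
    simpa [dotProduct] using Finset.sum_nonneg fun i _ => mul_nonneg (hd i) (hx.1 i)
  | cons j L ih =>
    intro hc k hk x hx
    rw [List.map_cons, List.prod_cons, map_mul, Module.End.mul_apply, hr.dotProduct]
    refine ih hc.tail j ?_ _ (hB.simpleReflection_mem_ascentCone (hk j (by simp)) hx)
    intro i hi
    rcases L with _ | ⟨m, L⟩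
    · simp at hi
    · simp only [List.head?_cons, Option.mem_def, Option.some.injEq] at hi
      subst hi
      exact (List.isChain_cons_cons.1 hc).1.symm

/-! ### The cone `T_J` and linear functionals that are nonnegative on it -/

theorem mem_orbit {A : Set (V l)} {x : V l} :
    x ∈ orbit r J A ↔ ∃ w ∈ parabolic J, ∃ d ∈ A, r w d = x := by
  simp [orbit]

theorem apply_mem_orbit {A : Set (V l)} {w : W l} (hw : w ∈ parabolic J) {x : V l}
    (hx : x ∈ orbit r J A) : r w x ∈ orbit r J A := by
  obtain ⟨u, hu, d, hd, rfl⟩ := mem_orbit.1 hx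
  exact mem_orbit.2 ⟨w * u, mul_mem hw hu, d, hd, by rw [map_mul, Module.End.mul_apply]⟩

theorem subset_orbit (A : Set (V l)) : A ⊆ orbit r J A := fun x hx =>
  mem_orbit.2 ⟨1, one_mem _, x, hx, by simp⟩

/-- The vector `∑_{j ∈ J} α_j`. -/
def sumRoot (J : Finset (Fin l)) : V l := fun i => if i ∈ J then 1 else 0

theorem row_dotProduct_sumRoot (j : Fin l) : B j ⬝ᵥ sumRoot J = ∑ k ∈ J, B j k := by
  simp [sumRoot, dotProduct, Finset.sum_ite_mem]

theorem IsLorentzianDatum.row_dotProduct_sumRoot_nonpos (hB : IsLorentzianDatum B J) (j : Fin l) :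
    B j ⬝ᵥ sumRoot J ≤ 0 := by
  rw [row_dotProduct_sumRoot]
  by_cases hj : j ∈ J
  · exact (hB.neg j hj).le
  · refine Finset.sum_nonpos fun k hk => ?_
    have : j ≠ k := fun h => hj (h ▸ hk)
    linarith [hB.le_neg_one j k this]

theorem IsLorentzianDatum.dotProduct_sumRoot_nonneg (hB : IsLorentzianDatum B J)
    (hr : IsContragredient B r) {f : V l} (hf : f ∈ orbit r J (orthant l)) :
    0 ≤ f ⬝ᵥ sumRoot J := by
  obtain ⟨w, hw, d, hd, rfl⟩ := mem_orbit.1 hf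
  obtain ⟨L, -, hc, rfl⟩ := exists_word hw
  have hQ : ∀ k, sumRoot J ∈ ascentCone B k := fun k => by
    refine ⟨fun i => ?_, fun m _ => ⟨hB.row_dotProduct_sumRoot_nonpos m, ?_⟩⟩
    · unfold sumRoot; split_ifs <;> norm_num
    · linarith [hB.row_dotProduct_sumRoot_nonpos m, hB.row_dotProduct_sumRoot_nonpos k]
  rcases L with _ | ⟨j, L⟩
  · simpa [dotProduct] using Finset.sum_nonneg fun i _ =>
      mul_nonneg (hd i) ((hQ hB.nonempty.choose).1 i)
  · rw [List.map_cons, List.prod_cons, map_mul, Module.End.mul_apply, hr.dotProduct]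
    by_cases hl : ∃ k : Fin l, k ≠ j
    · obtain ⟨k, hk⟩ := hl
      have := hB.word_dotProduct_nonneg hr hd (j :: L) hc k (by simpa using hk.symm) _ (hQ k)
      rwa [List.map_cons, List.prod_cons, map_mul, Module.End.mul_apply, hr.dotProduct] at this
    · push Not at hl
      -- `l = 1` is impossible, as `B_{jj} = 1` is not negative
      obtain ⟨k, hk⟩ := hB.nonempty
      have hkj := hl k
      subst hkj
      have h := hB.neg k hk
      have hJ : J = {k} := by
        ext i; simp only [Finset.mem_singleton]
        exact ⟨fun _ => hl i, fun h => h ▸ hk⟩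
      rw [hJ, Finset.sum_singleton, hB.diag] at h
      linarith

theorem IsLorentzianDatum.apply_nonneg (hB : IsLorentzianDatum B J)
    (hr : IsContragredient B r) {f : V l} (hf : f ∈ orbit r J (orthant l)) {i : Fin l}
    (hi : i ∉ J) : 0 ≤ f i := by
  obtain ⟨w, hw, d, hd, rfl⟩ := mem_orbit.1 hf
  obtain ⟨L, hL, hc, rfl⟩ := exists_word hw
  have hQ : Pi.single i 1 ∈ ascentCone B i := by
    refine ⟨fun k => ?_, fun m hm => ?_⟩
    · by_cases h : k = i
      · subst h; simp
      · simp [h]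
    · have := hB.le_neg_one m i hm
      rw [dotProduct_single, dotProduct_single, mul_one, mul_one, hB.diag]
      constructor <;> linarith
  have := hB.word_dotProduct_nonneg hr hd L hc i
    (fun j hj h => hi (h ▸ hL j (List.mem_of_mem_head? hj))) _ hQ
  simpa using this

/-- The vector `μ α_i + α_j`. It is isotropic if `μ² + 1 = -2 μ B_ij`. -/
def pairRoot (i j : Fin l) (μ : ℝ) : V l := μ • Pi.single i 1 + Pi.single j 1

theorem row_dotProduct_pairRoot (i j m : Fin l) (μ : ℝ) :
    B m ⬝ᵥ pairRoot i j μ = μ * B m i + B m j := by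
  simp [pairRoot, dotProduct_add]

/-- The isotropic vectors in the span of two simple roots are nonnegative on `T_J`: a reflection
in one of the two roots only swaps them, and any other one leads into the ascent cones. -/
theorem IsLorentzianDatum.dotProduct_pairRoot_nonneg (hB : IsLorentzianDatum B J)
    (hr : IsContragredient B r) {i j : Fin l} (hij : i ≠ j) {μ : ℝ} (hμ : 1 ≤ μ)
    (hμB : μ ^ 2 + 1 = -2 * μ * B i j) {f : V l} (hf : f ∈ orbit r J (orthant l)) :
    0 ≤ f ⬝ᵥ pairRoot i j μ := by
  have key : ∀ i j : Fin l, i ≠ j → μ ^ 2 + 1 = -2 * μ * B i j →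
      pairRoot i j μ ∈ ascentCone B i := by
    intro i j hij hμB
    refine ⟨fun k => ?_, fun m hm => ?_⟩
    · simp only [pairRoot, Pi.add_apply, Pi.smul_apply, smul_eq_mul, Pi.single_apply]
      split_ifs <;> linarith
    · rw [row_dotProduct_pairRoot, row_dotProduct_pairRoot, hB.diag]
      have hmi := hB.le_neg_one m i hm
      have h1 := mul_le_mul_of_nonneg_left hmi (show (0 : ℝ) ≤ μ by linarith)
      have h2 := hB.le_neg_one i j hij
      by_cases hmj : m = j
      · subst hmj
        rw [hB.diag, hB.symm m i] at *
        constructor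
        · linarith
        · have : 2 * μ * (μ * 1 + B i m + (μ * B i m + 1)) = (μ + 1) * (2 * μ + 2 * μ * B i m) := by
            ring
          have h3 : (μ + 1) * (2 * μ + 2 * μ * B i m) = -((μ + 1) * (μ - 1) ^ 2) := by
            linear_combination (μ + 1) * hμB
          have h4 : 0 ≤ (μ + 1) * (μ - 1) ^ 2 := by positivity
          by_contra! hc
          have : 0 < 2 * μ * (μ * 1 + B i m + (μ * B i m + 1)) :=
            mul_pos (by linarith) (by linarith)
          linarith
      · have hmj' := hB.le_neg_one m j hmj
        constructor <;> linarith
  obtain ⟨w, hw, d, hd, rfl⟩ := mem_orbit.1 hf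
  obtain ⟨L, -, hc, rfl⟩ := exists_word hw
  clear hf hw
  induction L generalizing i j with
  | nil =>
    simpa [dotProduct] using Finset.sum_nonneg fun k _ => mul_nonneg (hd k) ((key i j hij hμB).1 k)
  | cons k L ih =>
    by_cases hk : k = i
    · subst hk
      rw [List.map_cons, List.prod_cons, map_mul, Module.End.mul_apply, hr.dotProduct]
      have h : simpleReflection B k (pairRoot k j μ) = μ⁻¹ • pairRoot j k μ := by
        have hμ0 : μ ≠ 0 := by linarith
        have hc' : μ - 2 * (μ + B k j) = μ⁻¹ := by
          field_simp
          linear_combination -hμB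
        rw [simpleReflection, row_dotProduct_pairRoot, hB.diag, mul_one]
        ext m
        simp only [pairRoot, Pi.sub_apply, Pi.add_apply, Pi.smul_apply, smul_eq_mul]
        linear_combination (Pi.single k 1 : V l) m * hc' -
          (Pi.single j 1 : V l) m * inv_mul_cancel₀ hμ0
      rw [h, dotProduct_smul, smul_eq_mul]
      refine mul_nonneg (by positivity) (ih hij.symm (by rw [hB.symm]; exact hμB) hc.tail)
    · exact hB.word_dotProduct_nonneg hr hd (k :: L) hc i (by simpa using hk) _ (key i j hij hμB)

/-- On `T_J` the norm is controlled by the sum of the coordinates; in particular the closure of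
`T_J` contains no line. -/
theorem IsLorentzianDatum.exists_norm_le (hB : IsLorentzianDatum B J) (hr : IsContragredient B r) :
    ∃ C : ℝ, 0 < C ∧ ∀ f ∈ closure (orbit r J (orthant l)), ‖f‖ ≤ C * ∑ i, f i := by
  suffices h : ∃ C : ℝ, 0 < C ∧ ∀ f ∈ orbit r J (orthant l), ‖f‖ ≤ C * ∑ i, f i by
    obtain ⟨C, hC, h⟩ := h
    refine ⟨C, hC, fun f hf => ?_⟩
    exact closure_minimal (t := {f : V l | ‖f‖ ≤ C * ∑ i, f i}) h
      (isClosed_le (by fun_prop) (by fun_prop)) hf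
  -- `κ` bounds all `-1 / (2 B_j · z)` with `z = ∑_{j ∈ J} α_j`
  obtain ⟨κ, hκ0, hκ⟩ : ∃ κ : ℝ, 0 ≤ κ ∧ ∀ j ∈ J, (-2 * (B j ⬝ᵥ sumRoot J))⁻¹ ≤ κ := by
    refine ⟨∑ j ∈ J, |(-2 * (B j ⬝ᵥ sumRoot J))⁻¹|, Finset.sum_nonneg fun _ _ => abs_nonneg _,
      fun j hj => (le_abs_self _).trans ?_⟩
    exact Finset.single_le_sum (f := fun j => |(-2 * (B j ⬝ᵥ sumRoot J))⁻¹|)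
      (fun _ _ => abs_nonneg _) hj
  refine ⟨1 + l * κ, by positivity, fun f hf => ?_⟩
  set P := ∑ i, f i
  set z := f ⬝ᵥ sumRoot J with hz
  have hz0 : 0 ≤ z := hB.dotProduct_sumRoot_nonneg hr hf
  have hzJ : z = ∑ i ∈ J, f i := by simp [hz, sumRoot, dotProduct, Finset.sum_ite_mem]
  have hPz : P = z + ∑ i ∈ Finset.univ \ J, f i := by
    rw [hzJ, add_comm]; exact (Finset.sum_sdiff (Finset.subset_univ J)).symm
  have hP : z ≤ P := by
    rw [hPz]
    have : 0 ≤ ∑ i ∈ Finset.univ \ J, f i := Finset.sum_nonneg fun i hi =>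
      hB.apply_nonneg hr hf (by simpa using hi)
    linarith
  have hP0 : 0 ≤ P := hz0.trans hP
  have low : ∀ i, -(κ * P) ≤ f i := by
    intro i
    by_cases hi : i ∈ J
    · have h1 := hB.dotProduct_sumRoot_nonneg hr (apply_mem_orbit (s_mem_parabolic hi) hf)
      rw [hr, sub_dotProduct, smul_dotProduct, smul_eq_mul, ← hz] at h1
      have hneg : 0 < -2 * (B i ⬝ᵥ sumRoot J) := by
        have := hB.neg i hi
        rw [← row_dotProduct_sumRoot] at this
        linarith
      have h2 : -(z * (-2 * (B i ⬝ᵥ sumRoot J))⁻¹) ≤ f i := by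
        rw [← div_eq_mul_inv, ← neg_div, div_le_iff₀ hneg]
        linarith
      have h3 : z * (-2 * (B i ⬝ᵥ sumRoot J))⁻¹ ≤ κ * P := by
        rw [mul_comm κ]
        exact mul_le_mul hP (hκ i hi) (by positivity) hP0
      linarith
    · have := hB.apply_nonneg hr hf hi
      have : 0 ≤ κ * P := by positivity
      linarith
  have hl : ∀ i : Fin l, (1 : ℝ) ≤ l := fun i => by exact_mod_cast i.pos
  refine (pi_norm_le_iff_of_nonneg (by positivity)).2 fun i => ?_
  rw [Real.norm_eq_abs, abs_le]
  have hκP : 0 ≤ κ * P := by positivity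
  constructor
  · have := low i
    nlinarith [hl i]
  · have h1 : f i = P - ∑ k ∈ Finset.univ.erase i, f k := by
      rw [eq_sub_iff_add_eq, add_comm]; exact Finset.sum_erase_add _ _ (Finset.mem_univ i)
    have h2 : -(l * (κ * P)) ≤ ∑ k ∈ Finset.univ.erase i, f k := by
      have h3 : ∑ k ∈ Finset.univ.erase i, (-(κ * P)) ≤ ∑ k ∈ Finset.univ.erase i, f k :=
        Finset.sum_le_sum fun k _ => low k
      rw [Finset.sum_const, nsmul_eq_mul] at h3
      have h4 : ((Finset.univ.erase i).card : ℝ) ≤ l := by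
        exact_mod_cast (Finset.card_le_univ _).trans (by simp)
      nlinarith
    rw [h1]
    linarith

/-- A point of the chamber that lies on no wall, or only on the wall of one `s_j` with `j ∈ J`, is
interior to `T_J`. -/
theorem IsLorentzianDatum.mem_interior_orbit (hB : IsLorentzianDatum B J)
    (hr : IsContragredient B r) {j : Fin l} (hj : j ∈ J) {y : V l} (hy : ∀ k ≠ j, 0 < y k)
    (hyj : 0 ≤ y j) : y ∈ interior (orbit r J (orthant l)) := by
  rw [mem_interior]
  refine ⟨⋂ k, {u | k ≠ j → 0 < u k ∧ 0 < u k - 2 * u j * B j k}, fun u hu => ?_, ?_, ?_⟩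
  · simp only [Set.mem_iInter, Set.mem_ofPred_eq] at hu
    by_cases huj : 0 ≤ u j
    · refine subset_orbit _ fun k => ?_
      by_cases hk : k = j
      exacts [hk ▸ huj, (hu k hk).1.le]
    · rw [← apply_s_apply_s (r := r) j u]
      refine apply_mem_orbit (s_mem_parabolic hj) (subset_orbit _ fun k => ?_)
      rw [hr.apply]
      by_cases hk : k = j
      · rw [hk, hB.diag]; linarith
      · exact (hu k hk).2.le
  · refine isOpen_iInter_of_finite fun k => ?_
    by_cases hk : k = j
    · simp [hk]
    · simp only [ne_eq, hk, not_false_eq_true, forall_const]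
      exact IsOpen.inter
        (isOpen_lt (f := fun _ => (0 : ℝ)) (g := fun u : V l => u k) (by fun_prop) (by fun_prop))
        (isOpen_lt (f := fun _ => (0 : ℝ)) (g := fun u : V l => u k - 2 * u j * B j k)
          (by fun_prop) (by fun_prop))
  · simp only [Set.mem_iInter, Set.mem_ofPred_eq]
    intro k hk
    have h1 := hy k hk
    have h2 := hB.le_neg_one j k (Ne.symm hk)
    exact ⟨h1, by nlinarith⟩

/-! ### Lorentzian linear algebra in the span of the `α_j`, `j ∈ J` -/

theorem IsLorentzianDatum.dotProduct_mulVec_comm (hB : IsLorentzianDatum B J) (x y : V l) :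
    x ⬝ᵥ B.mulVec y = y ⬝ᵥ B.mulVec x := by
  have : B.transpose = B := by ext i j; exact hB.symm j i
  rw [Matrix.dotProduct_mulVec, ← Matrix.mulVec_transpose, this, dotProduct_comm]

theorem sumRoot_of_notMem {i : Fin l} (hi : i ∉ J) : sumRoot J i = 0 := by simp [sumRoot, hi]

theorem sum_sumRoot : ∑ i, sumRoot J i = J.card := by
  simp [sumRoot, Finset.sum_ite_mem]

theorem dotProduct_eq_zero_of_support {x y : V l} (hx : ∀ i ∉ J, x i = 0) (hy : ∀ i ∈ J, y i = 0) :
    x ⬝ᵥ y = 0 :=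
  Finset.sum_eq_zero fun i _ => by
    by_cases hi : i ∈ J
    · rw [hy i hi, mul_zero]
    · rw [hx i hi, zero_mul]

/-- The form is nondegenerate on the span of the `α_j`, `j ∈ J`. -/
theorem IsLorentzianDatum.eq_zero_of_radical (hB : IsLorentzianDatum B J) {x : V l}
    (hx : ∀ i ∉ J, x i = 0) (h : ∀ j ∈ J, B j ⬝ᵥ x = 0) : x = 0 := by
  obtain ⟨j, hj⟩ := hB.nonempty
  have hcard : (J.card : ℝ) ≠ 0 := by exact_mod_cast (Finset.card_pos.2 ⟨j, hj⟩).ne'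
  set z := sumRoot J with hz
  set c := (∑ i, x i) / J.card with hc
  have hzx : z ⬝ᵥ B.mulVec x = 0 :=
    dotProduct_eq_zero_of_support (fun i hi => sumRoot_of_notMem hi) h
  have hxx : x ⬝ᵥ B.mulVec x = 0 := dotProduct_eq_zero_of_support hx h
  have hzz : z ⬝ᵥ B.mulVec z ≤ 0 := Finset.sum_nonpos fun i _ =>
    mul_nonpos_of_nonneg_of_nonpos (by rw [hz]; unfold sumRoot; split_ifs <;> norm_num)
      (hB.row_dotProduct_sumRoot_nonpos i)
  have hu : x - c • z = 0 := by
    refine hB.pos _ (fun i hi => ?_) ?_ ?_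
    · simp [hx i hi, hz, sumRoot_of_notMem hi]
    · simp only [Pi.sub_apply, Pi.smul_apply, smul_eq_mul, Finset.sum_sub_distrib,
        ← Finset.mul_sum]
      rw [hz, sum_sumRoot, hc]
      field_simp
      ring
    · rw [Matrix.mulVec_sub, Matrix.mulVec_smul, dotProduct_sub, sub_dotProduct, sub_dotProduct,
        dotProduct_smul, dotProduct_smul, smul_dotProduct, smul_dotProduct,
        hB.dotProduct_mulVec_comm x z, hzx, hxx]
      simp only [smul_eq_mul, mul_zero, sub_zero, zero_sub, neg_neg]
      nlinarith [mul_self_nonneg c]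
  have hxc := sub_eq_zero.1 hu
  have := h j hj
  rw [hxc, dotProduct_smul, smul_eq_mul] at this
  have hneg := hB.neg j hj
  rw [← row_dotProduct_sumRoot] at hneg
  rcases mul_eq_zero.1 this with h0 | h0
  · rw [hxc, h0, zero_smul]
  · exact absurd h0 hneg.ne

/-- Orthogonal isotropic vectors of a Lorentzian space are parallel. -/
theorem IsLorentzianDatum.parallel_of_isotropic (hB : IsLorentzianDatum B J) {x y : V l}
    (hx : ∀ i ∉ J, x i = 0) (hy : ∀ i ∉ J, y i = 0) (hxx : x ⬝ᵥ B.mulVec x = 0)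
    (hyy : y ⬝ᵥ B.mulVec y = 0) (hxy : x ⬝ᵥ B.mulVec y = 0) :
    (∑ i, y i) • x = (∑ i, x i) • y := by
  refine sub_eq_zero.1 (hB.pos _ (fun i hi => ?_) ?_ ?_)
  · simp [hx i hi, hy i hi]
  · simp only [Pi.sub_apply, Pi.smul_apply, smul_eq_mul, Finset.sum_sub_distrib, ← Finset.mul_sum]
    ring
  · rw [Matrix.mulVec_sub, Matrix.mulVec_smul, Matrix.mulVec_smul, dotProduct_sub, sub_dotProduct,
      sub_dotProduct]
    simp only [dotProduct_smul, smul_dotProduct, hxx, hyy, hxy, hB.dotProduct_mulVec_comm y x,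
      smul_eq_mul, mul_zero, sub_zero, le_refl]

theorem IsLorentzianDatum.sum_ne_zero_of_isotropic (hB : IsLorentzianDatum B J) {x : V l}
    (hx : ∀ i ∉ J, x i = 0) (hxx : x ⬝ᵥ B.mulVec x = 0) (h0 : x ≠ 0) : ∑ i, x i ≠ 0 :=
  fun h => h0 (hB.pos x hx h hxx.le)

/-- `S` sends a functional `f` to the vector of the span of the `α_j`, `j ∈ J`, that represents the
restriction of `f` to this span. Then `S f ⬝ᵥ g` is the Lorentzian form, transported to
functionals (with radical the functionals that vanish on the span). -/
structure IsRepresenting (B : Matrix (Fin l) (Fin l) ℝ) (J : Finset (Fin l))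
    (S : V l →ₗ[ℝ] V l) : Prop where
  support : ∀ f, ∀ i ∉ J, S f i = 0
  row_dotProduct : ∀ f, ∀ j ∈ J, B j ⬝ᵥ S f = f j

theorem IsLorentzianDatum.exists_isRepresenting (hB : IsLorentzianDatum B J) :
    ∃ S : V l →ₗ[ℝ] V l, IsRepresenting B J S := by
  -- on the span of the `α_j`, `j ∈ J`, this is `B_J`; on the other coordinates it is the identity
  let A : V l →ₗ[ℝ] V l :=
    { toFun := fun x i => if i ∈ J then B i ⬝ᵥ x else x i
      map_add' := fun x y => by
        ext i; simp only [Pi.add_apply]; split_ifs <;> simp [dotProduct_add]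
      map_smul' := fun c x => by
        ext i; simp only [Pi.smul_apply]; split_ifs <;> simp [dotProduct_smul] }
  have hA : Function.Injective A := by
    rw [← LinearMap.ker_eq_bot, LinearMap.ker_eq_bot']
    intro x hx
    have hi : ∀ i, (if i ∈ J then B i ⬝ᵥ x else x i) = 0 := fun i => congrFun hx i
    exact hB.eq_zero_of_radical (fun i h => by simpa [h] using hi i)
      (fun i h => by simpa [h] using hi i)
  let e := LinearEquiv.ofInjectiveEndo A hA
  let π : V l →ₗ[ℝ] V l :=
    { toFun := fun f i => if i ∈ J then f i else 0
      map_add' := fun x y => by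
        ext i; simp only [Pi.add_apply]; split_ifs <;> simp
      map_smul' := fun c x => by
        ext i; simp only [Pi.smul_apply]; split_ifs <;> simp }
  have key : ∀ f i, (if i ∈ J then B i ⬝ᵥ (e.symm (π f)) else (e.symm (π f)) i)
      = if i ∈ J then f i else 0 := fun f i => congrFun (e.apply_symm_apply (π f)) i
  refine ⟨e.symm.toLinearMap ∘ₗ π, fun f i hi => ?_, fun f j hj => ?_⟩
  · simpa [hi] using key f i
  · simpa [hj] using key f j

/-! ### The dihedral subgroups `⟨s_i, s_j⟩` -/

/-- The functional `-𝓑(·, μ α_i + α_j)`. -/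
def pairWeight (B : Matrix (Fin l) (Fin l) ℝ) (i j : Fin l) (μ : ℝ) : V l := -(μ • B i + B j)

theorem IsLorentzianDatum.exists_ratio (hB : IsLorentzianDatum B J) {i j : Fin l} (hij : i ≠ j) :
    ∃ μ : ℝ, 1 ≤ μ ∧ μ ^ 2 + 1 = -2 * μ * B i j := by
  have hb := hB.le_neg_one i j hij
  have h0 : 0 ≤ B i j ^ 2 - 1 := by nlinarith
  refine ⟨-B i j + √(B i j ^ 2 - 1), by linarith [Real.sqrt_nonneg (B i j ^ 2 - 1)], ?_⟩
  linear_combination Real.sq_sqrt h0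

theorem ratio_gt_one {b μ : ℝ} (hb : b < -1) (hμ : 1 ≤ μ) (h : μ ^ 2 + 1 = -2 * μ * b) : 1 < μ := by
  refine lt_of_le_of_ne hμ ?_
  rintro rfl
  linarith

theorem IsContragredient.mul_apply_pair (hB : IsLorentzianDatum B J) (hr : IsContragredient B r)
    (i j : Fin l) (x y : ℝ) :
    r (s i * s j) (x • B i + y • B j) =
      (-(x - 2 * B i j * (y + 2 * B i j * x))) • B i + (-(y + 2 * B i j * x)) • B j := by
  ext k
  rw [map_mul, Module.End.mul_apply, hr.apply, hr.apply, hr.apply]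
  simp only [Pi.add_apply, Pi.smul_apply, smul_eq_mul, hB.diag, hB.symm j i]
  ring

theorem IsContragredient.mul_apply_pairWeight (hB : IsLorentzianDatum B J)
    (hr : IsContragredient B r) {i j : Fin l} {μ : ℝ} (h : μ ^ 2 + 1 = -2 * μ * B i j) :
    r (s i * s j) (pairWeight B i j μ) = μ ^ 2 • pairWeight B i j μ := by
  have h1 := hr.mul_apply_pair hB i j μ 1
  have e1 : pairWeight B i j μ = -(μ • B i + (1 : ℝ) • B j) := by rw [pairWeight, one_smul]
  rw [e1, map_neg, h1]
  have h2 : -(1 + 2 * B i j * μ) = μ ^ 2 := by linear_combination -h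
  have h3 : -(μ - 2 * B i j * (1 + 2 * B i j * μ)) = μ ^ 2 * μ := by
    linear_combination (2 * B i j - μ) * h
  rw [h2, h3]
  module

theorem IsContragredient.mul_apply_pairWeight_swap (hB : IsLorentzianDatum B J)
    (hr : IsContragredient B r) {i j : Fin l} {μ : ℝ} (hμ : 1 ≤ μ)
    (h : μ ^ 2 + 1 = -2 * μ * B i j) :
    r (s i * s j) (pairWeight B j i μ) = (μ ^ 2)⁻¹ • pairWeight B j i μ := by
  have h1 := hr.mul_apply_pairWeight hB (i := j) (j := i) (by rw [hB.symm]; exact h)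
  have h2 : μ ^ 2 ≠ 0 := by positivity
  rw [eq_inv_smul_iff₀ h2, ← map_smul, ← h1, ← Module.End.mul_apply, ← map_mul]
  have : (s i * s j) * (s j * s i) = (1 : W l) := by
    rw [mul_assoc, ← mul_assoc (s j), s_mul_s, one_mul, s_mul_s]
  rw [this, map_one, Module.End.one_apply]

theorem IsLorentzianDatum.pair_independent (hB : IsLorentzianDatum B J) {i j : Fin l}
    (hb : B i j < -1) {x y : ℝ} (h : x • B i + y • B j = 0) : x = 0 ∧ y = 0 := by
  have h1 := congrFun h i
  have h2 := congrFun h j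
  simp only [Pi.add_apply, Pi.smul_apply, smul_eq_mul, hB.diag, hB.symm j i, Pi.zero_apply] at h1 h2
  have hb2 : 1 - B i j ^ 2 ≠ 0 := by nlinarith
  constructor
  · refine (mul_eq_zero.1 (?_ : (1 - B i j ^ 2) * x = 0)).resolve_left hb2
    linear_combination h1 - B i j * h2
  · refine (mul_eq_zero.1 (?_ : (1 - B i j ^ 2) * y = 0)).resolve_left hb2
    linear_combination h2 - B i j * h1

theorem IsLorentzianDatum.pairWeight_ne_zero (hB : IsLorentzianDatum B J) {i j : Fin l}
    (hb : B i j < -1) (μ : ℝ) : pairWeight B i j μ ≠ 0 := by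
  intro h
  have := (hB.pair_independent hb (x := μ) (y := 1)
    (by rw [one_smul]; exact neg_eq_zero.1 h)).2
  norm_num at this

/-- The only eigenvalue of `s_i s_j` above `1` is `μ²`, and its eigenspace is a line. -/
theorem IsContragredient.eigen_classification (hB : IsLorentzianDatum B J)
    (hr : IsContragredient B r) {i j : Fin l} (hb : B i j < -1) {μ : ℝ} (hμ : 1 ≤ μ)
    (h : μ ^ 2 + 1 = -2 * μ * B i j) {lam : ℝ} (hlam : 1 < lam) {v : V l} (hv0 : v ≠ 0)
    (hv : r (s i * s j) v = lam • v) :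
    lam = μ ^ 2 ∧ ∃ τ : ℝ, τ ≠ 0 ∧ v = τ • pairWeight B i j μ := by
  obtain ⟨x, y, hxy⟩ : ∃ x y : ℝ, v = x • B i + y • B j := by
    -- `v` is a multiple of `r(s_i s_j) v - v`
    refine ⟨(lam - 1)⁻¹ * (-2 * (v i - 2 * v j * B j i)), (lam - 1)⁻¹ * (-2 * v j), ?_⟩
    have h1 : (lam - 1) • v = (-2 * (v i - 2 * v j * B j i)) • B i + (-2 * v j) • B j := by
      rw [sub_smul, ← hv, one_smul, map_mul, Module.End.mul_apply]
      ext k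
      simp only [Pi.sub_apply, hr.apply, Pi.add_apply, Pi.smul_apply, smul_eq_mul]
      ring
    have h2 : lam - 1 ≠ 0 := by linarith
    rw [← smul_right_injective _ h2 |>.eq_iff]
    rw [h1, smul_add, smul_smul, smul_smul, mul_inv_cancel_left₀ h2, mul_inv_cancel_left₀ h2]
  rw [hxy, hr.mul_apply_pair hB] at hv
  obtain ⟨e1, e2⟩ := hB.pair_independent hb
    (x := -(x - 2 * B i j * (y + 2 * B i j * x)) - lam * x)
    (y := -(y + 2 * B i j * x) - lam * y) (by
      rw [sub_smul, sub_smul, mul_smul, mul_smul]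
      rw [smul_add] at hv
      rw [← sub_eq_zero] at hv
      rw [← hv]
      abel)
  have hμ0 : μ ≠ 0 := by linarith
  have f1 : (lam + 1) * μ * y = (μ ^ 2 + 1) * x := by
    linear_combination -μ * e2 - x * h
  have f2 : (lam + 1) * μ * x = (μ ^ 2 + 1) * lam * y := by
    linear_combination (-μ) * e1 + (y + 2 * B i j * x) * h + (μ ^ 2 + 1) * e2
  have hy : y ≠ 0 := by
    rintro rfl
    have : x = 0 := by
      have h3 : (μ ^ 2 + 1) * x = 0 := by linear_combination -f1
      exact (mul_eq_zero.1 h3).resolve_left (by positivity)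
    subst this
    simp [hxy] at hv0
  have f3 : (lam - μ ^ 2) * (lam * μ ^ 2 - 1) = 0 := by
    refine (mul_eq_zero.1 (?_ : y * _ = 0)).resolve_left hy
    linear_combination (lam + 1) * μ * f1 + (μ ^ 2 + 1) * f2
  have f4 : lam = μ ^ 2 := by
    have : lam * μ ^ 2 - 1 ≠ 0 := by nlinarith
    linarith [(mul_eq_zero.1 f3).resolve_right this]
  refine ⟨f4, -y, neg_ne_zero.2 hy, ?_⟩
  have f5 : x = μ * y := by
    rw [f4] at f1
    have : (μ ^ 2 + 1) * (x - μ * y) = 0 := by linear_combination -f1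
    linarith [(mul_eq_zero.1 this).resolve_left (by positivity)]
  rw [hxy, f5, pairWeight]
  module

theorem IsLorentzianDatum.pairWeight_dotProduct_sumRoot_pos (hB : IsLorentzianDatum B J)
    {i j : Fin l} (hi : i ∈ J) (hj : j ∈ J) {μ : ℝ} (hμ : 1 ≤ μ) :
    0 < pairWeight B i j μ ⬝ᵥ sumRoot J := by
  rw [pairWeight, neg_dotProduct, add_dotProduct, smul_dotProduct, row_dotProduct_sumRoot,
    row_dotProduct_sumRoot, smul_eq_mul]
  have h1 := hB.neg i hi
  have h2 := hB.neg j hj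
  nlinarith

theorem apply_pow_eigenvector {g : W l} {v : V l} {c : ℝ} (h : r g v = c • v) (m : ℕ) :
    r (g ^ m) v = c ^ m • v := by
  induction m with
  | zero => simp
  | succ m ih => rw [pow_succ, map_mul, Module.End.mul_apply, h, map_smul, ih, smul_smul, pow_succ']

/-- The cones spanned by an expanding vector of `s_i s_j` and the `c_k`, `k ≠ i, j`, lie in the
closure of `T_J`: they are limits of translates of chamber points under `(s_i s_j)^m`. -/
theorem IsLorentzianDatum.add_pairWeight_mem_closure (hB : IsLorentzianDatum B J)
    (hr : IsContragredient B r) {i j : Fin l} (hi : i ∈ J) (hj : j ∈ J) (hij : i ≠ j) {μ : ℝ}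
    (hμ : 1 < μ) (h : μ ^ 2 + 1 = -2 * μ * B i j) {t : ℝ} (ht : 0 ≤ t) {u : V l}
    (hu : u ∈ orthant l) (hui : u i = 0) (huj : u j = 0) :
    t • pairWeight B i j μ + u ∈ closure (orbit r J (orthant l)) := by
  have hμ2 : 1 < μ ^ 2 := by nlinarith
  have hle : ∀ k, B i k + B j k ≤ 0 := by
    intro k
    by_cases hk : i = k
    · subst hk; rw [hB.diag]; linarith [hB.le_neg_one j i hij.symm]
    · have h1 := hB.le_neg_one i k hk
      by_cases hk' : j = k
      · subst hk'; rw [hB.diag]; linarith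
      · linarith [hB.le_neg_one j k hk']
  have hd : pairWeight B i j μ + pairWeight B j i μ ∈ orthant l := by
    intro k
    simp only [pairWeight, Pi.add_apply, Pi.neg_apply, Pi.smul_apply, smul_eq_mul]
    nlinarith [hle k]
  refine mem_closure_of_tendsto (b := atTop)
    (f := fun m : ℕ => t • pairWeight B i j μ +
      (t * (((μ ^ 2)⁻¹) ^ m * ((μ ^ 2)⁻¹) ^ m)) • pairWeight B j i μ + u) ?_
    (Eventually.of_forall fun m => ?_)
  · have h0 : Tendsto (fun m : ℕ => ((μ ^ 2)⁻¹) ^ m) atTop (𝓝 0) :=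
      tendsto_pow_atTop_nhds_zero_of_lt_one (by positivity) (inv_lt_one_of_one_lt₀ hμ2)
    have h1 := (((h0.mul h0).const_mul t).smul_const (pairWeight B j i μ)).const_add
      (t • pairWeight B i j μ) |>.add_const u
    simpa using h1
  · have hmem : (s i * s j) ^ m ∈ parabolic J :=
      pow_mem (mul_mem (s_mem_parabolic hi) (s_mem_parabolic hj)) m
    have h0 : (t * ((μ ^ 2)⁻¹) ^ m) • (pairWeight B i j μ + pairWeight B j i μ) + u ∈
        orbit r J (orthant l) := subset_orbit _ fun k => by
      have h1 := mul_nonneg (show 0 ≤ t * ((μ ^ 2)⁻¹) ^ m by positivity) (hd k)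
      have h2 := hu k
      simp only [Pi.add_apply, Pi.smul_apply, smul_eq_mul] at h1 ⊢
      linarith
    have hus : r (s i * s j) u = (1 : ℝ) • u := by
      rw [map_mul, Module.End.mul_apply, hr.apply_eq_self huj, hr.apply_eq_self hui, one_smul]
    have h1 := apply_mem_orbit hmem h0
    rw [map_add, map_smul, map_add, apply_pow_eigenvector hus,
      apply_pow_eigenvector (hr.mul_apply_pairWeight hB h),
      apply_pow_eigenvector (hr.mul_apply_pairWeight_swap hB hμ.le h), one_pow, one_smul,
      smul_add, smul_smul, smul_smul] at h1
    have e1 : t * (μ ^ 2)⁻¹ ^ m * (μ ^ 2) ^ m = t := by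
      rw [mul_assoc, ← mul_pow, inv_mul_cancel₀ (by positivity), one_pow, mul_one]
    rwa [e1, mul_assoc t] at h1

/-! ### The pieces of the boundary -/

/-- The union of the sets that the boundary of `T_J` is made of, before taking the closure. -/
def boundaryPieces {U : Type} [AddCommGroup U] [Module ℝ U] (r : Representation ℝ (W l) U)
    (J : Finset (Fin l)) (c : Fin l → U) (v : Fin l → Fin l → U) : Set U :=
  (⋃ i ∉ J, orbit r J (face c i)) ∪
    ⋃ i ∈ J, ⋃ j ∈ J, ⋃ _ : i ≠ j, orbit r J (cone c i j (v i j))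

/-- The fundamental weights `c_i` in the coordinates `f(α_k)`. -/
def weight (i : Fin l) : V l := Pi.single i 1

/-- What the vectors `v_ij` turn out to be: positive multiples of `-𝓑(·, μ α_i + α_j)` with
`μ α_i + α_j` isotropic and `μ > 1`, or `0` if `s_i s_j` is parabolic. -/
def IsBoundaryVector (B : Matrix (Fin l) (Fin l) ℝ) (i j : Fin l) (v : V l) : Prop :=
  (∃ μ τ : ℝ, 1 < μ ∧ μ ^ 2 + 1 = -2 * μ * B i j ∧ 0 < τ ∧ v = τ • pairWeight B i j μ) ∨
    (B i j = -1 ∧ v = 0)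

theorem sum_smul_weight_apply (A : Finset (Fin l)) (a : Fin l → ℝ) (m : Fin l) :
    (∑ k ∈ A, a k • weight k) m = if m ∈ A then a m else 0 := by
  simp [weight, Finset.sum_apply, Pi.single_apply]

theorem sum_smul_weight (y : V l) : ∑ k, y k • weight k = y := by
  ext m; rw [sum_smul_weight_apply, if_pos (Finset.mem_univ m)]

theorem mem_face {i : Fin l} {x : V l} : x ∈ face weight i ↔ x ∈ orthant l ∧ x i = 0 := by
  constructor
  · rintro ⟨a, ha, rfl⟩
    refine ⟨fun m => ?_, ?_⟩ <;> rw [sum_smul_weight_apply]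
    · split_ifs; exacts [ha m, le_rfl]
    · simp
  · rintro ⟨h, h0⟩
    refine ⟨x, h, ?_⟩
    ext m
    rw [sum_smul_weight_apply]
    by_cases hm : m = i
    · simp [hm, h0]
    · simp [hm]

theorem mem_cone {i j : Fin l} {v x : V l} : x ∈ cone weight i j v ↔
    ∃ t : ℝ, 0 ≤ t ∧ ∃ u ∈ orthant l, u i = 0 ∧ u j = 0 ∧ x = t • v + u := by
  constructor
  · rintro ⟨t, a, ht, ha, rfl⟩
    refine ⟨t, ht, _, fun m => ?_, ?_, ?_, rfl⟩ <;> rw [sum_smul_weight_apply]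
    · split_ifs; exacts [ha m, le_rfl]
    · simp
    · simp
  · rintro ⟨t, ht, u, hu, hi, hj, rfl⟩
    refine ⟨t, u, ht, hu, ?_⟩
    congr 1
    ext m
    rw [sum_smul_weight_apply]
    by_cases hm : m = i
    · simp [hm, hi]
    · by_cases hm' : m = j
      · simp [hm', hj]
      · simp [hm, hm']

theorem mem_boundaryPieces_of_face {v : Fin l → Fin l → V l} {i : Fin l} (hi : i ∉ J) {w : W l}
    (hw : w ∈ parabolic J) {x : V l} (hx : x ∈ face weight i) :
    r w x ∈ boundaryPieces r J weight v := by
  refine Or.inl (Set.mem_iUnion₂.2 ⟨i, hi, mem_orbit.2 ⟨w, hw, x, hx, rfl⟩⟩)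

theorem mem_boundaryPieces_of_cone {v : Fin l → Fin l → V l} {i j : Fin l} (hi : i ∈ J)
    (hj : j ∈ J) (hij : i ≠ j) {w : W l} (hw : w ∈ parabolic J) {x : V l}
    (hx : x ∈ cone weight i j (v i j)) : r w x ∈ boundaryPieces r J weight v := by
  refine Or.inr ?_
  simp only [Set.mem_iUnion]
  exact ⟨i, hi, j, hj, hij, mem_orbit.2 ⟨w, hw, x, hx, rfl⟩⟩

theorem boundaryPieces_cases {v : Fin l → Fin l → V l} {x : V l}
    (hx : x ∈ boundaryPieces r J weight v) : ∃ w ∈ parabolic J, ∃ d, r w d = x ∧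
      ((∃ i ∉ J, d ∈ face weight i) ∨
        ∃ i ∈ J, ∃ j ∈ J, i ≠ j ∧ d ∈ cone weight i j (v i j)) := by
  rcases hx with hx | hx
  · obtain ⟨i, hi, hx⟩ := Set.mem_iUnion₂.1 hx
    obtain ⟨w, hw, d, hd, rfl⟩ := mem_orbit.1 hx
    exact ⟨w, hw, d, rfl, Or.inl ⟨i, hi, hd⟩⟩
  · simp only [Set.mem_iUnion] at hx
    obtain ⟨i, hi, j, hj, hij, hx⟩ := hx
    obtain ⟨w, hw, d, hd, rfl⟩ := mem_orbit.1 hx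
    exact ⟨w, hw, d, rfl, Or.inr ⟨i, hi, j, hj, hij, hd⟩⟩

theorem apply_mem_closure {A : Set (V l)} {w : W l} (h : ∀ x ∈ A, r w x ∈ A) {x : V l}
    (hx : x ∈ closure A) : r w x ∈ closure A :=
  map_mem_closure (LinearMap.continuous_of_finiteDimensional (r w)) hx h

theorem apply_mem_boundaryPieces {v : Fin l → Fin l → V l} {w : W l} (hw : w ∈ parabolic J)
    {x : V l} (hx : x ∈ boundaryPieces r J weight v) : r w x ∈ boundaryPieces r J weight v := by
  obtain ⟨u, hu, d, rfl, ⟨i, hi, hd⟩ | ⟨i, hi, j, hj, hij, hd⟩⟩ := boundaryPieces_cases hx <;>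
    rw [← Module.End.mul_apply, ← map_mul]
  · exact mem_boundaryPieces_of_face hi (mul_mem hw hu) hd
  · exact mem_boundaryPieces_of_cone hi hj hij (mul_mem hw hu) hd

theorem inv_apply_apply (w : W l) (x : V l) : r w⁻¹ (r w x) = x := by
  rw [← Module.End.mul_apply, ← map_mul, inv_mul_cancel, map_one, Module.End.one_apply]

theorem apply_inv_apply (w : W l) (x : V l) : r w (r w⁻¹ x) = x := by
  rw [← Module.End.mul_apply, ← map_mul, mul_inv_cancel, map_one, Module.End.one_apply]

theorem apply_mem_interior {w : W l} (hw : w ∈ parabolic J) {x : V l} {A : Set (V l)}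
    (hx : x ∈ interior (orbit r J A)) : r w x ∈ interior (orbit r J A) := by
  have hc : Continuous (r w⁻¹) := LinearMap.continuous_of_finiteDimensional _
  refine interior_maximal (s := orbit r J A)
    (t := r w⁻¹ ⁻¹' interior (orbit r J A)) (fun y hy => ?_) (isOpen_interior.preimage hc) ?_
  · rw [← apply_inv_apply (r := r) w y]
    exact apply_mem_orbit hw (interior_subset hy)
  · rwa [Set.mem_preimage, inv_apply_apply]

theorem apply_mem_interior_closure {w : W l} (hw : w ∈ parabolic J) {x : V l} {A : Set (V l)}
    (hx : x ∈ interior (closure (orbit r J A))) : r w x ∈ interior (closure (orbit r J A)) := by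
  have hc : Continuous (r w⁻¹) := LinearMap.continuous_of_finiteDimensional _
  refine interior_maximal (s := closure (orbit r J A))
    (t := r w⁻¹ ⁻¹' interior (closure (orbit r J A))) (fun y hy => ?_)
    (isOpen_interior.preimage hc) ?_
  · rw [← apply_inv_apply (r := r) w y]
    exact apply_mem_closure (fun z hz => apply_mem_orbit hw hz) (interior_subset hy)
  · rwa [Set.mem_preimage, inv_apply_apply]

/-! ### The pieces lie in the boundary -/

theorem notMem_interior_of_supporting {T : Set (V l)} {z x : V l} (h : ∀ f ∈ T, 0 ≤ f ⬝ᵥ z)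
    (hxz : x ⬝ᵥ z = 0) {i : Fin l} (hi : 0 < z i) : x ∉ interior (closure T) := by
  intro hx
  have hcl : ∀ f ∈ closure T, 0 ≤ f ⬝ᵥ z := fun f hf =>
    closure_minimal (t := {f : V l | 0 ≤ f ⬝ᵥ z}) h
      (isClosed_le continuous_const (by unfold dotProduct; fun_prop)) hf
  have hc : Tendsto (fun ε : ℝ => x - ε • (Pi.single i 1 : V l)) (𝓝[>] 0) (𝓝 x) := by
    have : Continuous fun ε : ℝ => x - ε • (Pi.single i 1 : V l) := by fun_prop
    simpa using (this.tendsto 0).mono_left nhdsWithin_le_nhds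
  obtain ⟨ε, hε, hε0⟩ := ((hc.eventually (mem_interior_iff_mem_nhds.1 hx)).and
    self_mem_nhdsWithin).exists
  have := hcl _ hε
  rw [sub_dotProduct, smul_dotProduct, hxz] at this
  simp only [single_dotProduct, one_mul, smul_eq_mul, zero_sub] at this
  have : 0 < ε * z i := mul_pos hε0 hi
  linarith

theorem IsLorentzianDatum.pairWeight_dotProduct_pairRoot (hB : IsLorentzianDatum B J)
    {i j : Fin l} {μ : ℝ} (h : μ ^ 2 + 1 = -2 * μ * B i j) :
    pairWeight B i j μ ⬝ᵥ pairRoot i j μ = 0 := by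
  rw [pairWeight, neg_dotProduct, add_dotProduct, smul_dotProduct, row_dotProduct_pairRoot,
    row_dotProduct_pairRoot, hB.diag, hB.diag, hB.symm j i, smul_eq_mul]
  linear_combination -h

theorem IsLorentzianDatum.boundaryPieces_subset (hB : IsLorentzianDatum B J)
    (hr : IsContragredient B r) {v : Fin l → Fin l → V l}
    (hv : ∀ i ∈ J, ∀ j ∈ J, i ≠ j → IsBoundaryVector B i j (v i j)) :
    boundaryPieces r J weight v ⊆ frontier (closure (orbit r J (orthant l))) := by
  intro x hx
  obtain ⟨w, hw, d, rfl, hd⟩ := boundaryPieces_cases hx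
  suffices h : d ∈ closure (orbit r J (orthant l)) ∧
      d ∉ interior (closure (orbit r J (orthant l))) by
    rw [frontier, closure_closure]
    refine ⟨apply_mem_closure (fun z hz => apply_mem_orbit hw hz) h.1, fun hx' => h.2 ?_⟩
    rw [← inv_apply_apply (r := r) w d]
    exact apply_mem_interior_closure (inv_mem hw) hx'
  rcases hd with ⟨i, hi, hd⟩ | ⟨i, hi, j, hj, hij, hd⟩
  · rw [mem_face] at hd
    refine ⟨subset_closure (subset_orbit _ hd.1), notMem_interior_of_supporting
      (z := Pi.single i 1) (i := i) (fun f hf => ?_) ?_ (by simp)⟩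
    · simpa using hB.apply_nonneg hr hf hi
    · simpa using hd.2
  · obtain ⟨t, ht, u, hu, hui, huj, rfl⟩ := mem_cone.1 hd
    have hz : ∀ μ : ℝ, u ⬝ᵥ pairRoot i j μ = 0 := fun μ => by
      simp [pairRoot, dotProduct_add, hui, huj]
    rcases hv i hi j hj hij with ⟨μ, τ, hμ, h, hτ, hvij⟩ | ⟨hb, h0⟩
    · rw [hvij, smul_smul]
      refine ⟨hB.add_pairWeight_mem_closure hr hi hj hij hμ h (by positivity) hu hui huj,
        notMem_interior_of_supporting (z := pairRoot i j μ) (i := i)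
          (fun f hf => hB.dotProduct_pairRoot_nonneg hr hij hμ.le h hf) ?_ ?_⟩
      · rw [add_dotProduct, smul_dotProduct, hz, hB.pairWeight_dotProduct_pairRoot h]
        simp
      · simp [pairRoot, hij]; linarith
    · rw [h0, smul_zero, zero_add]
      refine ⟨subset_closure (subset_orbit _ hu),
        notMem_interior_of_supporting (z := pairRoot i j 1) (i := i)
          (fun f hf => hB.dotProduct_pairRoot_nonneg hr hij le_rfl (by rw [hb]; norm_num) hf)
          (hz 1) ?_⟩
      simp [pairRoot, hij]

/-! ### The invariant form on functionals -/

namespace IsRepresenting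

variable {S : V l →ₗ[ℝ] V l}

theorem dotProduct_mulVec (hS : IsRepresenting B J S) (f g : V l) :
    S f ⬝ᵥ B.mulVec (S g) = S f ⬝ᵥ g := by
  rw [← sub_eq_zero, ← dotProduct_sub]
  exact dotProduct_eq_zero_of_support (hS.support f) fun j hj =>
    sub_eq_zero.2 (hS.row_dotProduct g j hj)

theorem comm (hS : IsRepresenting B J S) (hB : IsLorentzianDatum B J) (f g : V l) :
    S f ⬝ᵥ g = S g ⬝ᵥ f := by
  rw [← hS.dotProduct_mulVec, hB.dotProduct_mulVec_comm, hS.dotProduct_mulVec]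

theorem apply_row (hS : IsRepresenting B J S) (hB : IsLorentzianDatum B J) {j : Fin l}
    (hj : j ∈ J) : S (B j) = Pi.single j 1 := by
  refine sub_eq_zero.1 (hB.eq_zero_of_radical (fun i hi => ?_) fun i hi => ?_)
  · have : i ≠ j := fun h => hi (h ▸ hj)
    simp [hS.support _ i hi, this]
  · rw [dotProduct_sub, hS.row_dotProduct _ i hi, dotProduct_single, mul_one, hB.symm, sub_self]

theorem invariant (hS : IsRepresenting B J S) (hB : IsLorentzianDatum B J)
    (hr : IsContragredient B r) {w : W l} (hw : w ∈ parabolic J) (f g : V l) :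
    S (r w f) ⬝ᵥ r w g = S f ⬝ᵥ g := by
  refine parabolic_induction (p := fun w => S (r w f) ⬝ᵥ r w g = S f ⬝ᵥ g) (by simp) ?_ hw
  intro j hj w _ ih
  rw [map_mul, Module.End.mul_apply, Module.End.mul_apply, ← ih]
  generalize r w f = f'
  generalize r w g = g'
  have h1 : S f' ⬝ᵥ B j = f' j := by rw [dotProduct_comm, hS.row_dotProduct _ j hj]
  rw [hr, hr, map_sub, map_smul, hS.apply_row hB hj]
  simp only [sub_dotProduct, dotProduct_sub, smul_dotProduct, dotProduct_smul, h1, smul_eq_mul,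
    single_dotProduct, one_mul, hB.diag]
  ring

/-- `W_J` moves functionals only by elements `𝓑(·, x)` with `x` in the span of the `α_j`,
`j ∈ J`. -/
theorem mulVec_sub_invariant (hS : IsRepresenting B J S) (hB : IsLorentzianDatum B J)
    (hr : IsContragredient B r) {w : W l} (hw : w ∈ parabolic J) (f : V l) :
    B.mulVec (S (r w f)) - r w f = B.mulVec (S f) - f := by
  refine parabolic_induction (p := fun w => B.mulVec (S (r w f)) - r w f = B.mulVec (S f) - f)
    (by simp) ?_ hw
  intro j hj w _ ih
  rw [map_mul, Module.End.mul_apply, ← ih]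
  generalize r w f = f'
  rw [hr, map_sub, map_smul, hS.apply_row hB hj, Matrix.mulVec_sub, Matrix.mulVec_smul]
  have : B.mulVec (Pi.single j 1) = B j := by
    ext i; simp [hB.symm]
  rw [this]
  abel

end IsRepresenting

theorem mulVec_pair (hB : IsLorentzianDatum B J) {i j : Fin l} (hij : i ≠ j) {x : V l}
    (hx : ∀ k, k ≠ i → k ≠ j → x k = 0) : B.mulVec x = x i • B i + x j • B j := by
  have hx' : x = x i • Pi.single i 1 + x j • Pi.single j 1 := by
    ext k
    by_cases hki : k = i
    · subst hki; simp [hij]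
    · by_cases hkj : k = j
      · subst hkj; simp [hki]
      · simp [hki, hkj, hx k hki hkj]
  ext m
  conv_lhs => rw [hx']
  simp [Matrix.mulVec_add, Matrix.mulVec_smul, hB.symm m]

/-! ### Every boundary point is a limit of the pieces -/

/-- A point of the closure of `T_J` of the form `u + 𝓑(·, x)` with `x` isotropic in the span of
`α_i` and `α_j` lies on one of the cones. -/
theorem IsLorentzianDatum.mem_boundaryPieces_of_pair (hB : IsLorentzianDatum B J)
    {v : Fin l → Fin l → V l}
    (hv : ∀ i ∈ J, ∀ j ∈ J, i ≠ j → IsBoundaryVector B i j (v i j)) {i j : Fin l} (hi : i ∈ J)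
    (hj : j ∈ J) (hij : i ≠ j) {u : V l} (hu : u ∈ orthant l) (hui : u i = 0) (huj : u j = 0)
    {p q : ℝ} (hnull : p ^ 2 + q ^ 2 + 2 * B i j * p * q = 0)
    (hpos : 0 ≤ (p • B i + q • B j) ⬝ᵥ sumRoot J) :
    u + (p • B i + q • B j) ∈ boundaryPieces r J weight v := by
  have hb := hB.le_neg_one i j hij
  have hpq : 0 ≤ p * q := by nlinarith [sq_nonneg p, sq_nonneg q]
  rw [add_dotProduct, smul_dotProduct, smul_dotProduct, row_dotProduct_sumRoot,
    row_dotProduct_sumRoot, smul_eq_mul, smul_eq_mul] at hpos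
  have hni := hB.neg i hi
  have hnj := hB.neg j hj
  obtain ⟨hp, hq⟩ : p ≤ 0 ∧ q ≤ 0 := by
    by_contra! hc
    rcases le_or_gt p 0 with hp | hp
    · have hq := hc hp
      have hp0 : p = 0 := by nlinarith
      subst hp0
      nlinarith
    · have hq : 0 ≤ q := by nlinarith
      nlinarith [mul_neg_of_pos_of_neg hp hni, mul_nonpos_of_nonneg_of_nonpos hq hnj.le]
  have mem : ∀ {i j : Fin l}, i ∈ J → j ∈ J → i ≠ j → ∀ {x : V l}, x ∈ cone weight i j (v i j) →
      x ∈ boundaryPieces r J weight v := fun {i j} hi hj hij {x} hx => by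
    simpa using mem_boundaryPieces_of_cone (r := r) hi hj hij (one_mem _) hx
  have expand : ∀ {i j : Fin l}, i ∈ J → j ∈ J → i ≠ j → u i = 0 → u j = 0 → ∀ {q μ τ : ℝ}, q ≤ 0 →
      0 < τ → v i j = τ • pairWeight B i j μ →
      u + ((μ * q) • B i + q • B j) ∈ boundaryPieces r J weight v := by
    intro i j hi hj hij hui huj q μ τ hq hτ hvij
    refine mem hi hj hij (mem_cone.2 ⟨-q / τ, by
      rw [neg_div]; exact neg_nonneg.2 (div_nonpos_of_nonpos_of_nonneg hq hτ.le), u, hu, hui, huj,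
      ?_⟩)
    rw [hvij, smul_smul, div_mul_cancel₀ _ hτ.ne', pairWeight]
    module
  rcases hv i hi j hj hij with ⟨μ, τ, hμ, h, hτ, hvij⟩ | ⟨hb1, h0⟩
  · by_cases hpμ : p = μ * q
    · rw [hpμ]; exact expand hi hj hij hui huj hq hτ hvij
    · have h1 : (p - μ * q) * (p * μ - q) = 0 := by
        linear_combination μ * hnull - p * q * h
      have hqμ : q = μ * p := by
        linarith [(mul_eq_zero.1 h1).resolve_left (sub_ne_zero.2 hpμ)]
      rcases hv j hj i hi hij.symm with ⟨μ', τ', hμ', h', hτ', hvji⟩ | ⟨hb1, -⟩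
      · have h2 : (q - μ' * p) * (q * μ' - p) = 0 := by
          rw [hB.symm] at h'
          linear_combination μ' * hnull - p * q * h'
        rcases mul_eq_zero.1 h2 with h3 | h3
        · rw [sub_eq_zero.1 h3, add_comm (p • B i)]
          exact expand hj hi hij.symm huj hui hp hτ' hvji
        · exfalso
          have h4 : (μ * μ' - 1) * p = 0 := by rw [hqμ] at h3; linear_combination h3
          have h5 : p = 0 := (mul_eq_zero.1 h4).resolve_left (by nlinarith)
          exact hpμ (by rw [hqμ, h5]; simp)
      · rw [hB.symm] at hb1
        rw [hb1] at h
        nlinarith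
  · have hpq' : p = q := by
      rw [hb1] at hnull
      have : (p - q) ^ 2 = 0 := by linear_combination hnull
      exact sub_eq_zero.1 (pow_eq_zero_iff (by norm_num) |>.1 this)
    subst hpq'
    refine mem hi hj hij
      (mem_cone.2 ⟨0, le_rfl, _, fun k => ?_, ?_, ?_, by rw [zero_smul, zero_add]⟩)
    · have hk : B i k + B j k ≤ 0 := by
        by_cases hki : i = k
        · subst hki; rw [hB.diag, hB.symm, hb1]; norm_num
        · have := hB.le_neg_one i k hki
          by_cases hkj : j = k
          · subst hkj; rw [hB.diag]; linarith
          · linarith [hB.le_neg_one j k hkj]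
      have := hu k
      simp only [Pi.add_apply, Pi.smul_apply, smul_eq_mul]
      nlinarith
    · simp [hui, hB.diag, hB.symm j i, hb1]
    · simp [huj, hB.diag, hb1]

/-- The main case: a boundary point is given as the limit of translates `r(w_m) y_m` of chamber
points, where the weights `c_k` occurring in the limit of the `y_m` are already fixed by all
`w_m`. -/
theorem IsLorentzianDatum.mem_closure_of_limit (hB : IsLorentzianDatum B J)
    (hr : IsContragredient B r) {v : Fin l → Fin l → V l}
    (hv : ∀ i ∈ J, ∀ j ∈ J, i ≠ j → IsBoundaryVector B i j (v i j))
    {w : ℕ → W l} (hw : ∀ m, w m ∈ parabolic J) {y : ℕ → V l} (hy : ∀ m, y m ∈ orthant l)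
    {Y : V l} (hY : Tendsto y atTop (𝓝 Y)) {E : Fin l → V l}
    (hE : ∀ k, Tendsto (fun m => y m k • r (w m) (weight k)) atTop (𝓝 (E k)))
    (hfix : ∀ k, Y k ≠ 0 → ∀ m, r (w m) (weight k) = weight k)
    (hint : ∑ k, E k ∉ interior (orbit r J (orthant l))) :
    ∑ k, E k ∈ closure (boundaryPieces r J weight v) := by
  classical
  have hYk : ∀ k, Tendsto (fun m => y m k) atTop (𝓝 (Y k)) := fun k =>
    (continuous_apply k).continuousAt.tendsto.comp hY
  have hYO : Y ∈ orthant l := fun k => ge_of_tendsto' (hYk k) fun m => hy m k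
  have hfixE : ∀ k, (∀ m, r (w m) (weight k) = weight k) → E k = Y k • weight k := by
    intro k hk
    refine tendsto_nhds_unique (hE k) ?_
    simp only [hk]
    exact (hYk k).smul_const _
  have hfixJ : ∀ k ∉ J, ∀ m, r (w m) (weight k) = weight k := fun k hk m =>
    hr.eq_self_of_mem (J := J) (fun j hj => by
      have : j ≠ k := fun h => hk (h ▸ hj)
      simp [weight, this]) (hw m)
  have hsum : ∀ m, ∑ k, y m k • r (w m) (weight k) = r (w m) (y m) := fun m => by
    conv_rhs => rw [← sum_smul_weight (y m), map_sum]
    simp only [map_smul]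
  have hlim : Tendsto (fun m => r (w m) (y m)) atTop (𝓝 (∑ k, E k)) := by
    simp only [← hsum]
    exact tendsto_finsetSum _ fun k _ => hE k
  by_cases hA : ∃ k ∉ J, Y k = 0
  · -- the coordinate `k ∉ J` may be dropped from `y_m`
    obtain ⟨k, hk, hk0⟩ := hA
    have hEk : E k = 0 := by rw [hfixE k (hfixJ k hk), hk0, zero_smul]
    refine mem_closure_of_tendsto (b := atTop)
      (f := fun m => r (w m) (y m) - y m k • r (w m) (weight k)) ?_
      (Eventually.of_forall fun m => ?_)
    · simpa [hEk] using hlim.sub (hE k)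
    · rw [← map_smul, ← map_sub]
      refine mem_boundaryPieces_of_face hk (hw m) (mem_face.2 ⟨fun i => ?_, by simp [weight]⟩)
      by_cases hi : i = k
      · simp [hi, weight]
      · simpa [hi, weight] using hy m i
  push Not at hA
  set M := Finset.univ.filter fun k => Y k = 0 with hM
  have hMmem : ∀ k, k ∈ M ↔ Y k = 0 := fun k => by simp [hM]
  have hMJ : ∀ k ∈ M, k ∈ J := fun k hk => by
    by_contra hkJ
    exact hA k hkJ ((hMmem k).1 hk)
  obtain ⟨S, hS⟩ := hB.exists_isRepresenting
  have hEM : ∀ k ∉ M, E k = Y k • weight k := fun k hk =>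
    hfixE k (hfix k fun h => hk ((hMmem k).2 h))
  have hf : ∑ k, E k = Y + ∑ k ∈ M, E k := by
    rw [← Finset.sum_sdiff (Finset.subset_univ M)]
    congr 1
    rw [Finset.sum_congr rfl fun k hk => hEM k (Finset.mem_sdiff.1 hk).2]
    conv_rhs => rw [← sum_smul_weight Y]
    refine Finset.sum_subset (Finset.subset_univ _) fun k _ hk => ?_
    have : k ∈ M := by simpa using hk
    rw [(hMmem k).1 this, zero_smul]
  -- the limits `E j`, `j ∈ M`, are orthogonal to everything, since the `y_m j` tend to zero while
  -- `r (w m)` preserves the form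
  have horth : ∀ j ∈ M, ∀ k, S (E j) ⬝ᵥ E k = 0 := by
    intro j hj k
    have hc : Continuous fun p : V l × V l => S p.1 ⬝ᵥ p.2 := by
      have := LinearMap.continuous_of_finiteDimensional S
      unfold dotProduct
      fun_prop
    have h1 : Tendsto (fun m => y m j * y m k * (S (weight j) ⬝ᵥ weight k)) atTop
        (𝓝 (S (E j) ⬝ᵥ E k)) := by
      refine (hc.continuousAt.tendsto.comp ((hE j).prodMk_nhds (hE k))).congr fun m => ?_
      simp only [Function.comp_apply]
      rw [map_smul, smul_dotProduct, dotProduct_smul, hS.invariant hB hr (hw m), smul_eq_mul,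
        smul_eq_mul, mul_assoc]
    have h2 := ((hYk j).mul (hYk k)).mul_const (S (weight j) ⬝ᵥ weight k)
    rw [(hMmem j).1 hj, zero_mul, zero_mul] at h2
    exact tendsto_nhds_unique h1 h2
  have hrep : ∀ j ∈ M, B.mulVec (S (E j)) = E j := by
    intro j hj
    have hc : Continuous (B.toLin' ∘ₗ S - LinearMap.id : V l →ₗ[ℝ] V l) :=
      LinearMap.continuous_of_finiteDimensional _
    have h1 : Tendsto (fun m => y m j • (B.mulVec (S (weight j)) - weight j)) atTop
        (𝓝 (B.mulVec (S (E j)) - E j)) := by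
      refine (hc.continuousAt.tendsto.comp (hE j)).congr fun m => ?_
      rw [← hS.mulVec_sub_invariant hB hr (hw m)]
      simp only [Function.comp_apply, LinearMap.sub_apply, LinearMap.comp_apply,
        Matrix.toLin'_apply, LinearMap.id_apply, map_smul, smul_sub]
    have h2 := (hYk j).smul_const (B.mulVec (S (weight j)) - weight j)
    rw [(hMmem j).1 hj, zero_smul] at h2
    exact sub_eq_zero.1 (tendsto_nhds_unique h1 h2)
  have hsupp : ∀ j ∈ M, ∀ k ∉ M, S (E j) k = 0 := by
    intro j hj k hk
    have h := horth j hj k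
    rw [hEM k hk, dotProduct_smul, weight, dotProduct_single, mul_one, smul_eq_mul] at h
    exact (mul_eq_zero.1 h).resolve_left fun h => hk ((hMmem k).2 h)
  have hcl : ∀ k, E k ∈ closure (orbit r J (orthant l)) := fun k =>
    mem_closure_of_tendsto (hE k) (Eventually.of_forall fun m => by
      rw [← map_smul]
      refine apply_mem_orbit (hw m) (subset_orbit _ fun i => ?_)
      by_cases hi : i = k
      · subst hi; simpa [weight] using hy m i
      · simp [weight, hi])
  -- the sum `G` of the limits `E j`, `j ∈ M`, is represented by an isotropic vector
  set G := ∑ k ∈ M, E k with hG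
  have hSG : S G = ∑ k ∈ M, S (E k) := map_sum S _ _
  have hGrep : B.mulVec (S G) = G := by
    rw [hSG, Matrix.mulVec_sum]
    exact Finset.sum_congr rfl hrep
  have hGsupp : ∀ k ∉ M, S G k = 0 := fun k hk => by
    rw [hSG, Finset.sum_apply]
    exact Finset.sum_eq_zero fun j hj => hsupp j hj k hk
  have hGorth : ∀ k, S G ⬝ᵥ E k = 0 := fun k => by
    rw [hSG, sum_dotProduct]
    exact Finset.sum_eq_zero fun j hj => horth j hj k
  have hGnull : S G ⬝ᵥ G = 0 := by
    rw [hG, dotProduct_sum]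
    exact Finset.sum_eq_zero fun k _ => hGorth k
  have hYM : ∀ k ∈ M, Y k = 0 := fun k hk => (hMmem k).1 hk
  rw [hf] at hint ⊢
  have hYpos : ∀ k ∉ M, 0 < Y k := fun k hk =>
    lt_of_le_of_ne (hYO k) fun h => hk ((hMmem k).2 h.symm)
  rcases Nat.lt_or_ge M.card 2 with hcard | hcard
  · -- at most one coordinate of the limit vanishes: the point is interior
    exfalso
    obtain ⟨j, hjJ, hj⟩ : ∃ j ∈ J, ∀ k ∈ M, k = j := by
      rcases M.eq_empty_or_nonempty with h | ⟨j, hj⟩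
      · obtain ⟨j, hj⟩ := hB.nonempty
        exact ⟨j, hj, fun k hk => by simp [h] at hk⟩
      · exact ⟨j, hMJ j hj, fun k hk => Finset.card_le_one.1 (by omega) k hk j hj⟩
    have hx : S G = S G j • Pi.single j 1 := by
      ext k
      by_cases hk : k = j
      · subst hk; simp
      · simp [hk, hGsupp k fun h => hk (hj k h)]
    have hGj : S G j = 0 := by
      have h : S G ⬝ᵥ B.mulVec (S G) = 0 := by rw [hGrep, hGnull]
      rw [hx] at h
      simpa [Matrix.mulVec_smul, hB.diag] using h
    have hG0 : G = 0 := by rw [← hGrep, hx, hGj, zero_smul, Matrix.mulVec_zero]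
    rw [hG0, add_zero] at hint
    exact hint (hB.mem_interior_orbit hr hjJ (fun k hk => hYpos k fun h => hk (hj k h)) (hYO j))
  rcases hcard.eq_or_lt with hcard | hcard
  · -- two vanishing coordinates: the isotropic vector lies in the span of `α_i` and `α_j`
    obtain ⟨i, j, hij, hMij⟩ := Finset.card_eq_two.1 hcard.symm
    have hi : i ∈ M := by simp [hMij]
    have hj : j ∈ M := by simp [hMij]
    have hGp := mulVec_pair hB hij (x := S G) fun k hki hkj => hGsupp k (by simp [hMij, hki, hkj])
    rw [hGrep] at hGp
    refine subset_closure ?_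
    rw [hGp]
    refine hB.mem_boundaryPieces_of_pair hv (hMJ i hi) (hMJ j hj) hij hYO (hYM i hi) (hYM j hj)
      ?_ ?_
    · have h : S G ⬝ᵥ (S G i • B i + S G j • B j) = 0 := by rw [← hGp, hGnull]
      rw [dotProduct_add, dotProduct_smul, dotProduct_smul, dotProduct_comm,
        hS.row_dotProduct G i (hMJ i hi), dotProduct_comm, hS.row_dotProduct G j (hMJ j hj)] at h
      have e1 := congrFun hGp i
      have e2 := congrFun hGp j
      simp only [Pi.add_apply, Pi.smul_apply, smul_eq_mul, hB.diag, hB.symm j i] at e1 e2 h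
      rw [e1, e2] at h
      linear_combination h
    · rw [← hGp, hG, sum_dotProduct]
      refine Finset.sum_nonneg fun k _ => ?_
      exact closure_minimal (t := {f : V l | 0 ≤ f ⬝ᵥ sumRoot J})
        (fun f hf => hB.dotProduct_sumRoot_nonneg hr hf)
        (isClosed_le continuous_const (by unfold dotProduct; fun_prop)) (hcl k)
  · -- three vanishing coordinates: all `E k`, `k ∈ M`, are parallel, so that a single `y_m j`
    -- suffices, and two other coordinates may be dropped
    have cone0 : ∀ {i j : Fin l}, i ∈ M → j ∈ M → i ≠ j → ∀ {w' : W l}, w' ∈ parabolic J →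
        ∀ {u : V l}, u ∈ orthant l → u i = 0 → u j = 0 → r w' u ∈ boundaryPieces r J weight v :=
      fun {i j} hi hj hij {w'} hw' {u} hu hui huj =>
        mem_boundaryPieces_of_cone (hMJ _ hi) (hMJ _ hj) hij hw'
          (mem_cone.2 ⟨0, le_rfl, u, hu, hui, huj, by simp⟩)
    by_cases hE0 : ∀ k ∈ M, E k = 0
    · obtain ⟨i, hi, j, hj, hij⟩ := Finset.one_lt_card.1 (show 1 < M.card by omega)
      have := cone0 hi hj hij (one_mem _) hYO (hYM i hi) (hYM j hj)
      rw [map_one, Module.End.one_apply] at this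
      rw [hG, Finset.sum_eq_zero hE0, add_zero]
      exact subset_closure this
    push Not at hE0
    obtain ⟨j, hj, hj0⟩ := hE0
    obtain ⟨i, hi, i', hi', hii'⟩ := Finset.one_lt_card.1
      (show 1 < (M.erase j).card by rw [Finset.card_erase_of_mem hj]; omega)
    obtain ⟨C, hC, hnorm⟩ := hB.exists_norm_le hr
    have hpos : ∀ k, 0 ≤ ∑ i, E k i := fun k =>
      nonneg_of_mul_nonneg_right ((norm_nonneg _).trans (hnorm _ (hcl k))) hC
    have hposj : 0 < ∑ i, E j i :=
      (mul_pos_iff_of_pos_left hC).1 ((norm_pos_iff.2 hj0).trans_le (hnorm _ (hcl j)))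
    have hxj0 : S (E j) ≠ 0 := fun h => hj0 (by rw [← hrep j hj, h, Matrix.mulVec_zero])
    have hjnull : S (E j) ⬝ᵥ B.mulVec (S (E j)) = 0 := by rw [hrep j hj, horth j hj]
    have hne := hB.sum_ne_zero_of_isotropic (hS.support _) hjnull hxj0
    have hpar := hB.parallel_of_isotropic (hS.support _) (hS.support G) hjnull
      (by rw [hGrep, hGnull]) (by rw [hS.dotProduct_mulVec, hS.comm hB, hGorth])
    set t := (∑ i, S (E j) i)⁻¹ * ∑ i, S G i with ht
    have hGt : G = t • E j := by
      have h := congrArg B.mulVec hpar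
      rw [Matrix.mulVec_smul, Matrix.mulVec_smul, hGrep, hrep j hj] at h
      rw [ht, mul_smul, h, smul_smul, inv_mul_cancel₀ hne, one_smul]
    have ht0 : 0 ≤ t := by
      have h1 : 0 ≤ ∑ i, G i := by
        simp only [hG, Finset.sum_apply]
        rw [Finset.sum_comm]
        exact Finset.sum_nonneg fun k _ => hpos k
      have h2 : ∑ i, G i = t * ∑ i, E j i := by
        rw [hGt, Finset.mul_sum]; rfl
      rw [h2] at h1
      exact nonneg_of_mul_nonneg_left h1 hposj
    rw [hGt]
    refine mem_closure_of_tendsto (b := atTop)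
      (f := fun m => r (w m) (Y + (t * y m j) • weight j)) ?_ (Eventually.of_forall fun m => ?_)
    · have hYfix : ∀ m, r (w m) Y = Y := fun m => by
        conv_lhs => rw [← sum_smul_weight Y, map_sum]
        conv_rhs => rw [← sum_smul_weight Y]
        refine Finset.sum_congr rfl fun k _ => ?_
        rw [map_smul]
        by_cases hk : Y k = 0
        · rw [hk, zero_smul, zero_smul]
        · rw [hfix k hk]
      simp only [map_add, hYfix, map_smul, mul_smul]
      exact ((hE j).const_smul t).const_add Y
    · have hij : i ≠ j := (Finset.mem_erase.1 hi).1
      have hij' : i' ≠ j := (Finset.mem_erase.1 hi').1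
      refine cone0 (Finset.mem_of_mem_erase hi) (Finset.mem_of_mem_erase hi') hii' (hw m)
        (fun k => ?_) ?_ ?_
      · have := hYO k
        by_cases hk : k = j
        · subst hk
          have := mul_nonneg ht0 (hy m k)
          simpa [weight] using add_nonneg (hYO k) this
        · simpa [weight, hk] using this
      · simp [weight, hij, hYM i (Finset.mem_of_mem_erase hi)]
      · simp [weight, hij', hYM i' (Finset.mem_of_mem_erase hi')]

/-! ### Discreteness of the orbits of the weights -/

theorem IsLorentzianDatum.exists_int_apply_weight (hB : IsLorentzianDatum B J)
    (hr : IsContragredient B r) {w : W l} (hw : w ∈ parabolic J) (k i : Fin l) :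
    ∃ z : ℤ, r w (weight k) i = z := by
  refine parabolic_induction (p := fun w => ∀ i, ∃ z : ℤ, r w (weight k) i = z) ?_ ?_ hw i
  · intro i
    by_cases h : i = k
    · exact ⟨1, by simp [weight, h]⟩
    · exact ⟨0, by simp [weight, h]⟩
  · intro j _ w _ ih i
    obtain ⟨a, ha⟩ := ih i
    obtain ⟨b, hb⟩ := ih j
    obtain ⟨c, hc⟩ := hB.int j i
    refine ⟨a - b * c, ?_⟩
    rw [map_mul, Module.End.mul_apply, hr.apply, ha, hb]
    push_cast
    rw [← hc]
    ring

theorem eventually_eq_of_tendsto_of_int {u : ℕ → V l} (hu : ∀ m i, ∃ z : ℤ, u m i = z) {a : V l}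
    (ha : Tendsto u atTop (𝓝 a)) : ∃ b, ∀ᶠ m in atTop, u m = b := by
  obtain ⟨m₀, hm₀⟩ := (Metric.tendsto_atTop.1 ha) (1 / 2) (by norm_num)
  refine ⟨u m₀, eventually_atTop.2 ⟨m₀, fun m hm => ?_⟩⟩
  ext i
  obtain ⟨z, hz⟩ := hu m i
  obtain ⟨z', hz'⟩ := hu m₀ i
  have h1 := (dist_le_pi_dist (u m) a i).trans_lt (hm₀ m hm)
  have h2 := (dist_le_pi_dist (u m₀) a i).trans_lt (hm₀ m₀ le_rfl)
  have h3 := (dist_triangle_right (u m i) (u m₀ i) (a i)).trans_lt (add_lt_add h1 h2)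
  rw [hz, hz', Int.dist_cast_real, Int.dist_eq'] at h3
  have h4 : |z - z'| < 1 := by exact_mod_cast (by linarith : ((|z - z'| : ℤ) : ℝ) < 1)
  rw [hz, hz', sub_eq_zero.1 (Int.abs_lt_one_iff.1 h4)]

/-! ### The boundary of `T_J` in coordinates -/

theorem IsLorentzianDatum.frontier_subset (hB : IsLorentzianDatum B J)
    (hr : IsContragredient B r) {v : Fin l → Fin l → V l}
    (hv : ∀ i ∈ J, ∀ j ∈ J, i ≠ j → IsBoundaryVector B i j (v i j)) :
    frontier (closure (orbit r J (orthant l))) ⊆ closure (boundaryPieces r J weight v) := by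
  intro f hf
  rw [frontier, closure_closure] at hf
  obtain ⟨hfc, hfi⟩ := hf
  replace hfi : f ∉ interior (orbit r J (orthant l)) := fun h =>
    hfi (interior_mono subset_closure h)
  obtain ⟨x, hx, hxf⟩ := mem_closure_iff_seq_limit.1 hfc
  choose w hw y hy hwy using fun m => mem_orbit.1 (hx m)
  obtain ⟨C, hC, hnorm⟩ := hB.exists_norm_le hr
  have hE : ∀ m, ∑ k, y m k • r (w m) (weight k) = x m := fun m => by
    rw [← hwy m]
    conv_rhs => rw [← sum_smul_weight (y m), map_sum]
    simp only [map_smul]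
  have hweight : ∀ k, (weight k : V l) ∈ orthant l := fun k i => by
    by_cases h : i = k
    · simp [weight, h]
    · simp [weight, h]
  have hT : ∀ m k, r (w m) (weight k) ∈ closure (orbit r J (orthant l)) := fun m k =>
    subset_closure (mem_orbit.2 ⟨w m, hw m, _, hweight k, rfl⟩)
  have hET : ∀ m k, y m k • r (w m) (weight k) ∈ closure (orbit r J (orthant l)) := fun m k => by
    rw [← map_smul]
    exact subset_closure (mem_orbit.2 ⟨w m, hw m, _, fun i => mul_nonneg (hy m k) (hweight k i),
      rfl⟩)
  -- the coordinate sum of a lattice vector of `T_J` is a positive integer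
  have hone : ∀ m k, 1 ≤ ∑ i, r (w m) (weight k) i := by
    intro m k
    have h0 : r (w m) (weight k) ≠ 0 := fun h => by
      have h1 := congrArg (r (w m)⁻¹) h
      rw [inv_apply_apply, map_zero] at h1
      simpa [weight] using congrFun h1 k
    have h1 : 0 < ∑ i, r (w m) (weight k) i :=
      (mul_pos_iff_of_pos_left hC).1 ((norm_pos_iff.2 h0).trans_le (hnorm _ (hT m k)))
    choose z hz using hB.exists_int_apply_weight hr (hw m) k
    simp only [hz] at h1 ⊢
    exact_mod_cast h1
  have hEpos : ∀ m k, 0 ≤ ∑ i, (y m k • r (w m) (weight k)) i := fun m k =>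
    nonneg_of_mul_nonneg_right ((norm_nonneg _).trans (hnorm _ (hET m k))) hC
  obtain ⟨R, hR⟩ : ∃ R, ∀ m, ∑ i, x m i ≤ R := by
    have h1 : Tendsto (fun m => ∑ i, x m i) atTop (𝓝 (∑ i, f i)) :=
      tendsto_finsetSum _ fun i _ => (continuous_apply i).continuousAt.tendsto.comp hxf
    obtain ⟨R, hR⟩ := h1.bddAbove_range
    exact ⟨R, fun m => hR ⟨m, rfl⟩⟩
  have hER : ∀ m k, ∑ i, (y m k • r (w m) (weight k)) i ≤ R := fun m k => by
    refine le_trans ?_ (hR m)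
    rw [← hE m]
    simp only [Finset.sum_apply]
    rw [Finset.sum_comm]
    exact Finset.single_le_sum (f := fun k => ∑ i, (y m k • r (w m) (weight k)) i)
      (fun k _ => hEpos m k) (Finset.mem_univ k)
  have hyR : ∀ m k, y m k ≤ R := fun m k => by
    refine le_trans ?_ (hER m k)
    simp only [Pi.smul_apply, smul_eq_mul, ← Finset.mul_sum]
    exact le_mul_of_one_le_right (hy m k) (hone m k)
  have hR0 : 0 ≤ R := by
    obtain ⟨j, -⟩ := hB.nonempty
    exact (hy 0 j).trans (hyR 0 j)
  obtain ⟨⟨Y, E⟩, -, φ, hφ, hlim⟩ := tendsto_subseq_of_bounded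
    (s := Metric.closedBall (0 : V l × (Fin l → V l)) (max R (C * R))) Metric.isBounded_closedBall
    (x := fun m => (y m, fun k => y m k • r (w m) (weight k))) (fun m => by
      rw [mem_closedBall_zero_iff, Prod.norm_def]
      refine max_le_max ((pi_norm_le_iff_of_nonneg hR0).2 fun k => ?_)
        ((pi_norm_le_iff_of_nonneg (by positivity)).2 fun k => ?_)
      · rw [Real.norm_eq_abs, abs_of_nonneg (hy m k)]
        exact hyR m k
      · exact (hnorm _ (hET m k)).trans (mul_le_mul_of_nonneg_left (hER m k) hC.le))
  rw [Prod.tendsto_iff] at hlim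
  obtain ⟨hlimY, hlimE⟩ := hlim
  simp only [Function.comp_apply] at hlimY hlimE
  have hlimE' := tendsto_pi_nhds.1 hlimE
  have hconst : ∀ k, ∃ b, Y k ≠ 0 → ∀ᶠ m in atTop, r (w (φ m)) (weight k) = b := by
    intro k
    by_cases hk : Y k = 0
    · exact ⟨0, fun h => absurd hk h⟩
    · have h1 := tendsto_pi_nhds.1 hlimY k
      have h2 : Tendsto (fun m => r (w (φ m)) (weight k)) atTop (𝓝 ((Y k)⁻¹ • E k)) := by
        refine ((h1.inv₀ hk).smul (hlimE' k)).congr' ?_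
        filter_upwards [h1.eventually_ne hk] with m hm
        rw [smul_smul, inv_mul_cancel₀ hm, one_smul]
      obtain ⟨b, hb⟩ := eventually_eq_of_tendsto_of_int
        (fun m i => hB.exists_int_apply_weight hr (hw (φ m)) k i) h2
      exact ⟨b, fun _ => hb⟩
  choose b hb using hconst
  obtain ⟨m₀, hm₀⟩ := eventually_atTop.1 (eventually_all.2 fun k =>
    (eventually_imp_distrib_left (p := Y k ≠ 0)).2 (hb k))
  -- translate by `w_{m₀}⁻¹`, so that the weights in question become fixed
  set g := w (φ m₀) with hg
  have hgJ : g ∈ parabolic J := hw _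
  have hsum : ∑ k, E k = f := by
    refine tendsto_nhds_unique (tendsto_finsetSum Finset.univ fun k _ => hlimE' k) ?_
    simp only [hE]
    exact hxf.comp hφ.tendsto_atTop
  have key := hB.mem_closure_of_limit hr hv (w := fun m => g⁻¹ * w (φ (m + m₀)))
    (fun m => mul_mem (inv_mem hgJ) (hw _)) (y := fun m => y (φ (m + m₀))) (fun m => hy _)
    (hlimY.comp (tendsto_add_atTop_nat m₀)) (E := fun k => r g⁻¹ (E k)) (fun k => ?_)
    (fun k hk m => ?_) (fun hi => hfi ?_)
  · rw [← map_sum, hsum] at key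
    rw [← apply_inv_apply (r := r) g f]
    exact apply_mem_closure (fun z hz => apply_mem_boundaryPieces hgJ hz) key
  · have hc : Continuous (r g⁻¹) := LinearMap.continuous_of_finiteDimensional _
    refine ((hc.tendsto _).comp ((hlimE' k).comp (tendsto_add_atTop_nat m₀))).congr fun m => ?_
    simp only [Function.comp_apply]
    rw [map_smul, map_mul, Module.End.mul_apply]
  · rw [map_mul, Module.End.mul_apply, hm₀ (m + m₀) (Nat.le_add_left _ _) k hk,
      ← hm₀ m₀ le_rfl k hk, ← hg, inv_apply_apply]
  · rw [← map_sum, hsum] at hi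
    rw [← apply_inv_apply (r := r) g f]
    exact apply_mem_interior hgJ hi

theorem IsLorentzianDatum.frontier_eq (hB : IsLorentzianDatum B J)
    (hr : IsContragredient B r) {v : Fin l → Fin l → V l}
    (hv : ∀ i ∈ J, ∀ j ∈ J, i ≠ j → IsBoundaryVector B i j (v i j)) :
    frontier (closure (orbit r J (orthant l))) = closure (boundaryPieces r J weight v) :=
  (hB.frontier_subset hr hv).antisymm
    (closure_minimal (hB.boundaryPieces_subset hr hv) isClosed_frontier)

/-! ### Expanding vectors -/

theorem IsLorentzianDatum.isBoundaryVector_of_isExpandingVector (hB : IsLorentzianDatum B J)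
    (hr : IsContragredient B r) {i j : Fin l} (hi : i ∈ J) (hj : j ∈ J) (hij : i ≠ j)
    (hb : B i j < -1) {v : V l} (hv : IsExpandingVector r (orbit r J (orthant l)) i j v) :
    IsBoundaryVector B i j v := by
  obtain ⟨⟨lam, hlam, hvec⟩, hcl⟩ := hv
  obtain ⟨μ, hμ, h⟩ := hB.exists_ratio hij
  obtain ⟨-, τ, hτ0, hτ⟩ := hr.eigen_classification hB hb hμ h hlam hvec.2 hvec.apply_eq_smul
  refine Or.inl ⟨μ, τ, ratio_gt_one hb hμ h, h, lt_of_le_of_ne ?_ hτ0.symm, hτ⟩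
  -- the sign is determined by the functional `∑_{j ∈ J} α_j`, which is nonnegative on `T_J`
  have h1 : 0 ≤ v ⬝ᵥ sumRoot J := closure_minimal (t := {f : V l | 0 ≤ f ⬝ᵥ sumRoot J})
    (fun f hf => hB.dotProduct_sumRoot_nonneg hr hf)
    (isClosed_le continuous_const (by unfold dotProduct; fun_prop)) hcl
  rw [hτ, smul_dotProduct, smul_eq_mul] at h1
  exact nonneg_of_mul_nonneg_left h1 (hB.pairWeight_dotProduct_sumRoot_pos hi hj hμ)

theorem IsLorentzianDatum.exists_eigenvector (hB : IsLorentzianDatum B J)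
    (hr : IsContragredient B r) {i j : Fin l} (hi : i ∈ J) (hj : j ∈ J) (hij : i ≠ j)
    (hb : B i j < -1) :
    (∃! lam : ℝ, 1 < lam ∧ Module.End.HasEigenvalue (r (s i * s j)) lam) ∧
      ∃ v, IsExpandingVector r (orbit r J (orthant l)) i j v := by
  obtain ⟨μ, hμ, h⟩ := hB.exists_ratio hij
  have hμ1 := ratio_gt_one hb hμ h
  have hvec : Module.End.HasEigenvector (r (s i * s j)) (μ ^ 2) (pairWeight B i j μ) :=
    Module.End.hasEigenvector_iff.2 ⟨Module.End.mem_eigenspace_iff.2 (hr.mul_apply_pairWeight hB h),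
      hB.pairWeight_ne_zero hb μ⟩
  have hμ2 : 1 < μ ^ 2 := by nlinarith
  refine ⟨⟨μ ^ 2, ⟨hμ2, Module.End.hasEigenvalue_of_hasEigenvector hvec⟩, ?_⟩,
    pairWeight B i j μ, ⟨μ ^ 2, hμ2, hvec⟩, ?_⟩
  · rintro lam ⟨hlam, heig⟩
    obtain ⟨v, hv⟩ := heig.exists_hasEigenvector
    exact (hr.eigen_classification hB hb hμ h hlam hv.2 hv.apply_eq_smul).1
  · have := hB.add_pairWeight_mem_closure hr hi hj hij hμ1 h zero_le_one (u := 0)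
      (fun _ => le_rfl) rfl rfl
    simpa using this

/-! ### Transfer to the dual space and to `V` -/

section Transfer

variable {U : Type} [AddCommGroup U] [Module ℝ U]

/-- The representation in coordinates, obtained from a representation on `U` through a linear
equivalence. -/
def coordRep (ρ : Representation ℝ (W l) U) (e : U ≃ₗ[ℝ] V l) : Representation ℝ (W l) (V l) where
  toFun w := e.toLinearMap ∘ₗ ρ w ∘ₗ e.symm.toLinearMap
  map_one' := by ext; simp
  map_mul' a b := by ext; simp

theorem coordRep_apply (ρ : Representation ℝ (W l) U) (e : U ≃ₗ[ℝ] V l) (w : W l) (x : U) :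
    coordRep ρ e w (e x) = e (ρ w x) := by
  simp [coordRep]

theorem image_orbit (ρ : Representation ℝ (W l) U) (e : U ≃ₗ[ℝ] V l) (A : Set U) :
    e '' orbit ρ J A = orbit (coordRep ρ e) J (e '' A) := by
  simp only [orbit, Set.image_iUnion, Set.image_image, coordRep_apply]

theorem image_face (e : U ≃ₗ[ℝ] V l) {c : Fin l → U} (hc : ∀ i, e (c i) = weight i) (i : Fin l) :
    e '' face c i = face weight i := by
  ext x
  constructor
  · rintro ⟨_, ⟨a, ha, rfl⟩, rfl⟩
    exact ⟨a, ha, by simp [hc]⟩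
  · rintro ⟨a, ha, rfl⟩
    exact ⟨_, ⟨a, ha, rfl⟩, by simp [hc]⟩

theorem image_cone (e : U ≃ₗ[ℝ] V l) {c : Fin l → U} (hc : ∀ i, e (c i) = weight i)
    (i j : Fin l) (v : U) : e '' cone c i j v = cone weight i j (e v) := by
  ext x
  constructor
  · rintro ⟨_, ⟨t, a, ht, ha, rfl⟩, rfl⟩
    exact ⟨t, a, ht, ha, by simp [hc]⟩
  · rintro ⟨t, a, ht, ha, rfl⟩
    exact ⟨_, ⟨t, a, ht, ha, rfl⟩, by simp [hc]⟩

theorem image_boundaryPieces (ρ : Representation ℝ (W l) U) (e : U ≃ₗ[ℝ] V l) {c : Fin l → U}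
    (hc : ∀ i, e (c i) = weight i) (v : Fin l → Fin l → U) :
    e '' boundaryPieces ρ J c v =
      boundaryPieces (coordRep ρ e) J weight fun i j => e (v i j) := by
  simp only [boundaryPieces, Set.image_union, Set.image_iUnion, image_orbit, image_face e hc,
    image_cone e hc]

theorem hasEigenvector_coordRep (ρ : Representation ℝ (W l) U) (e : U ≃ₗ[ℝ] V l) (w : W l)
    (lam : ℝ) (v : U) : Module.End.HasEigenvector (coordRep ρ e w) lam (e v) ↔
      Module.End.HasEigenvector (ρ w) lam v := by
  rw [Module.End.hasEigenvector_iff, Module.End.hasEigenvector_iff,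
    Module.End.mem_eigenspace_iff, Module.End.mem_eigenspace_iff, coordRep_apply, ← map_smul,
    e.injective.eq_iff, ne_eq, ne_eq, e.map_eq_zero_iff]

theorem hasEigenvalue_coordRep (ρ : Representation ℝ (W l) U) (e : U ≃ₗ[ℝ] V l) (w : W l)
    (lam : ℝ) : Module.End.HasEigenvalue (coordRep ρ e w) lam ↔
      Module.End.HasEigenvalue (ρ w) lam := by
  constructor <;> intro h <;> obtain ⟨v, hv⟩ := h.exists_hasEigenvector
  · rw [← e.apply_symm_apply v, hasEigenvector_coordRep] at hv
    exact Module.End.hasEigenvalue_of_hasEigenvector hv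
  · exact Module.End.hasEigenvalue_of_hasEigenvector ((hasEigenvector_coordRep ρ e w lam v).2 hv)

/-- The description of the boundary for any representation that becomes the contragredient one in
suitable linear coordinates. -/
theorem IsLorentzianDatum.boundary [TopologicalSpace U] (hB : IsLorentzianDatum B J) {n : ℕ}
    (hn : 1 ≤ n)
    (h2 : 2 ≤ n → ∀ i ∈ J, ∀ j ∈ J, i ≠ j → B i j < -1)
    (h1 : n = 1 → ∀ i ∈ J, ∀ j ∈ J, i ≠ j → B i j = -1)
    (ρ : Representation ℝ (W l) U) (e : U ≃ₗ[ℝ] V l) (hcont : Continuous e)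
    (hcont' : Continuous e.symm) {c : Fin l → U} (hc : ∀ i, e (c i) = weight i) {D : Set U}
    (hD : ∀ x, x ∈ D ↔ e x ∈ orthant l) (hρ : ∀ j x, e (ρ (s j) x) = e x - (2 * e x j) • B j) :
    (2 ≤ n → ∀ i ∈ J, ∀ j ∈ J, i ≠ j →
        (∃! lam : ℝ, 1 < lam ∧ Module.End.HasEigenvalue (ρ (s i * s j)) lam) ∧
        ∃ v, IsExpandingVector ρ (orbit ρ J D) i j v) ∧
      ∀ v : Fin l → Fin l → U,
        (2 ≤ n → ∀ i ∈ J, ∀ j ∈ J, i ≠ j → IsExpandingVector ρ (orbit ρ J D) i j (v i j)) →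
        (n = 1 → ∀ i ∈ J, ∀ j ∈ J, i ≠ j → v i j = 0) →
        frontier (closure (orbit ρ J D)) = closure (boundaryPieces ρ J c v) := by
  let E : U ≃ₜ V l := ⟨e.toEquiv, hcont, hcont'⟩
  have hE : ∀ A : Set U, E '' A = e '' A := fun A => rfl
  have hr : IsContragredient B (coordRep ρ e) := fun j f => by
    obtain ⟨x, rfl⟩ := e.surjective f
    rw [coordRep_apply, hρ]
  have hDim : e '' D = orthant l := by
    ext f
    obtain ⟨x, rfl⟩ := e.surjective f
    rw [← hD, e.injective.mem_set_image]
  have hexp : ∀ i j v, IsExpandingVector (coordRep ρ e) (orbit (coordRep ρ e) J (orthant l)) i j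
      (e v) ↔ IsExpandingVector ρ (orbit ρ J D) i j v := fun i j v => by
    unfold IsExpandingVector
    simp only [hasEigenvector_coordRep]
    rw [← hDim, ← image_orbit, ← hE, ← E.image_closure, hE, e.injective.mem_set_image]
  refine ⟨fun hn i hi j hj hij => ?_, fun v hv2 hv1 => ?_⟩
  · obtain ⟨h, v, hv⟩ := hB.exists_eigenvector hr hi hj hij (h2 hn i hi j hj hij)
    simp only [hasEigenvalue_coordRep] at h
    rw [← e.apply_symm_apply v, hexp] at hv
    exact ⟨h, _, hv⟩
  · have h := hB.frontier_eq hr (v := fun i j => e (v i j)) fun i hi j hj hij => by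
      rcases hn.eq_or_lt with h | h
      · exact Or.inr ⟨h1 h.symm i hi j hj hij, by rw [hv1 h.symm i hi j hj hij, map_zero]⟩
      · exact hB.isBoundaryVector_of_isExpandingVector hr hi hj hij (h2 h i hi j hj hij)
          ((hexp i j _).2 (hv2 h i hi j hj hij))
    rw [← hDim, ← image_orbit, ← image_boundaryPieces ρ e hc, ← hE, ← hE, ← E.image_closure,
      ← E.image_closure, ← E.image_frontier] at h
    exact E.injective.image_injective h

/-- Coordinates on the dual space: the values at the simple roots. -/
def dualCoord (l : ℕ) : Module.Dual ℝ (V l) ≃ₗ[ℝ] V l where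
  toFun f i := f (simpleRoot i)
  invFun y := ∑ k, y k • dualRoot k
  map_add' _ _ := rfl
  map_smul' _ _ := rfl
  left_inv f := by
    refine LinearMap.pi_ext' fun i => LinearMap.ext_ring ?_
    simp [dualRoot, simpleRoot, Pi.single_apply]
  right_inv y := by
    ext i
    simp [dualRoot, simpleRoot, Pi.single_apply]

/-- Coordinates on `V`: the products `𝓑(w, α_i)`. -/
def formCoord (B : Matrix (Fin l) (Fin l) ℝ) : V l →ₗ[ℝ] V l where
  toFun w i := form B w (simpleRoot i)
  map_add' _ _ := by ext; simp
  map_smul' _ _ := by ext; simp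

theorem form_simpleRoot (B : Matrix (Fin l) (Fin l) ℝ) (i j : Fin l) :
    form B (simpleRoot i) (simpleRoot j) = B i j := by
  simp [form, simpleRoot, Matrix.toBilin'_single]

theorem IsLorentzianDatum.geomRep_s_apply (hB : IsLorentzianDatum B J) (j : Fin l) (w : V l) :
    geomRep B (s j) w = w - (2 * form B w (simpleRoot j)) • simpleRoot j := by
  rw [geomRep_s, sigma_apply, form_simpleRoot, hB.diag, div_one]

theorem IsLorentzianDatum.boundary_dual (hB : IsLorentzianDatum B J) {n : ℕ} (hn : 1 ≤ n)
    (h2 : 2 ≤ n → ∀ i ∈ J, ∀ j ∈ J, i ≠ j → B i j < -1)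
    (h1 : n = 1 → ∀ i ∈ J, ∀ j ∈ J, i ≠ j → B i j = -1) :
    (2 ≤ n → ∀ i ∈ J, ∀ j ∈ J, i ≠ j →
        (∃! lam : ℝ, 1 < lam ∧ Module.End.HasEigenvalue ((geomRep B).dual (s i * s j)) lam) ∧
        ∃ v, IsExpandingVector (geomRep B).dual
          (orbit (geomRep B).dual J (dualChamber l)) i j v) ∧
      ∀ v : Fin l → Fin l → Module.Dual ℝ (V l),
        (2 ≤ n → ∀ i ∈ J, ∀ j ∈ J, i ≠ j → IsExpandingVector (geomRep B).dual
          (orbit (geomRep B).dual J (dualChamber l)) i j (v i j)) →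
        (n = 1 → ∀ i ∈ J, ∀ j ∈ J, i ≠ j → v i j = 0) →
        frontier (closure (orbit (geomRep B).dual J (dualChamber l))) =
          closure (boundaryPieces (geomRep B).dual J dualRoot v) := by
  refine hB.boundary hn h2 h1 _ (dualCoord l) ?_ ?_ (fun i => ?_) (fun _ => Iff.rfl)
    (fun j f => ?_)
  · exact continuous_pi fun i => (continuous_apply (simpleRoot i)).comp continuous_induced_dom
  · refine continuous_induced_rng.2 (continuous_pi fun x => ?_)
    simp only [dualCoord, Function.comp_apply, LinearEquiv.coe_symm_mk, LinearMap.sum_apply,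
      LinearMap.smul_apply]
    fun_prop
  · ext k
    simp [dualCoord, dualRoot, simpleRoot, weight, Pi.single_apply, eq_comm]
  · ext i
    rw [Representation.dual_apply, s_inv]
    change f (geomRep B (s j) (simpleRoot i)) = f (simpleRoot i) - 2 * f (simpleRoot j) * B j i
    rw [hB.geomRep_s_apply, form_simpleRoot, map_sub, map_smul, smul_eq_mul, hB.symm i j]
    ring

theorem IsLorentzianDatum.boundary_of_dualBasis (hB : IsLorentzianDatum B J) {n : ℕ} (hn : 1 ≤ n)
    (h2 : 2 ≤ n → ∀ i ∈ J, ∀ j ∈ J, i ≠ j → B i j < -1)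
    (h1 : n = 1 → ∀ i ∈ J, ∀ j ∈ J, i ≠ j → B i j = -1) {c : Fin l → V l}
    (hc : ∀ i j, form B (c i) (simpleRoot j) = if i = j then 1 else 0) :
    (2 ≤ n → ∀ i ∈ J, ∀ j ∈ J, i ≠ j →
        (∃! lam : ℝ, 1 < lam ∧ Module.End.HasEigenvalue (geomRep B (s i * s j)) lam) ∧
        ∃ v, IsExpandingVector (geomRep B) (orbit (geomRep B) J (chamber B)) i j v) ∧
      ∀ v : Fin l → Fin l → V l,
        (2 ≤ n → ∀ i ∈ J, ∀ j ∈ J, i ≠ j → IsExpandingVector (geomRep B)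
          (orbit (geomRep B) J (chamber B)) i j (v i j)) →
        (n = 1 → ∀ i ∈ J, ∀ j ∈ J, i ≠ j → v i j = 0) →
        frontier (closure (orbit (geomRep B) J (chamber B))) =
          closure (boundaryPieces (geomRep B) J c v) := by
  have hcw : ∀ i, formCoord B (c i) = weight i := fun i => by
    ext j
    change form B (c i) (simpleRoot j) = _
    rw [hc, weight, Pi.single_apply]
    simp only [eq_comm]
  have hsurj : Function.Surjective (formCoord B) := fun y =>
    ⟨∑ k, y k • c k, by simp only [map_sum, map_smul, hcw, sum_smul_weight]⟩
  refine hB.boundary hn h2 h1 _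
    (LinearEquiv.ofBijective (formCoord B) ⟨LinearMap.injective_iff_surjective.2 hsurj, hsurj⟩)
    (LinearMap.continuous_of_finiteDimensional (formCoord B))
    (LinearMap.continuous_of_finiteDimensional (LinearEquiv.toLinearMap _)) hcw
    (fun _ => Iff.rfl) (fun j w => ?_)
  ext i
  change form B (geomRep B (s j) w) (simpleRoot i) =
    form B w (simpleRoot i) - 2 * form B w (simpleRoot j) * B j i
  rw [hB.geomRep_s_apply, map_sub, map_smul, LinearMap.sub_apply, LinearMap.smul_apply,
    form_simpleRoot, smul_eq_mul]

end Transfer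

end Boundary

section Degrees

variable {l n : ℕ}

/-! ### The intersection numbers `b_ij` -/

theorem coeff_linear_mul (b : Fin l → ℕ) (F : MvPolynomial (Fin l) ℕ) (d : Fin l →₀ ℕ) :
    MvPolynomial.coeff d ((∑ m, MvPolynomial.C (b m) * MvPolynomial.X m) * F) =
      ∑ m, b m * if d m ≠ 0 then MvPolynomial.coeff (d - Finsupp.single m 1) F else 0 := by
  rw [Finset.sum_mul, MvPolynomial.coeff_sum]
  refine Finset.sum_congr rfl fun m _ => ?_
  rw [mul_assoc, MvPolynomial.coeff_C_mul, MvPolynomial.coeff_X_mul']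
  simp only [Finsupp.mem_support_iff]

theorem coeff_prod_linear_pow {κ : Type*} [DecidableEq κ] (a : κ → Fin l → ℕ) (j : Fin l)
    (A : Finset κ) : MvPolynomial.coeff (Finsupp.single j A.card)
      (∏ k ∈ A, ∑ m, MvPolynomial.C (a k m) * MvPolynomial.X m : MvPolynomial (Fin l) ℕ) =
      ∏ k ∈ A, a k j := by
  induction A using Finset.induction_on with
  | empty => simp
  | insert k A hk ih =>
    rw [Finset.prod_insert hk, Finset.prod_insert hk, coeff_linear_mul,
      Finset.card_insert_of_notMem hk,
      Finset.sum_eq_single j, Finsupp.single_eq_same, if_pos (Nat.succ_ne_zero _),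
      ← Finsupp.single_tsub, Nat.add_sub_cancel, ih]
    · intro m _ hm
      simp [hm]
    · simp

theorem coeff_prod_linear {κ : Type*} [DecidableEq κ] (a : κ → Fin l → ℕ) {i j : Fin l}
    (hij : i ≠ j) (A : Finset κ) : ∀ m : ℕ, A.card = m + 1 →
      MvPolynomial.coeff (Finsupp.single i 1 + Finsupp.single j m)
        (∏ k ∈ A, ∑ m, MvPolynomial.C (a k m) * MvPolynomial.X m : MvPolynomial (Fin l) ℕ) =
        ∑ k ∈ A, a k i * ∏ k' ∈ A.erase k, a k' j := by
  induction A using Finset.induction_on with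
  | empty => simp
  | insert k A hk ih =>
    intro m hm
    rw [Finset.card_insert_of_notMem hk, Nat.add_right_cancel_iff] at hm
    have hs : ∑ k' ∈ A, a k' i * ∏ q ∈ (insert k A).erase k', a q j =
        a k j * ∑ k' ∈ A, a k' i * ∏ q ∈ A.erase k', a q j := by
      rw [Finset.mul_sum]
      refine Finset.sum_congr rfl fun k' hk' => ?_
      have hne : k ≠ k' := fun h => hk (h ▸ hk')
      rw [Finset.erase_insert_of_ne hne, Finset.prod_insert fun h => hk (Finset.mem_of_mem_erase h)]
      ring
    have hi : (Finsupp.single i 1 + Finsupp.single j m - Finsupp.single i 1 : Fin l →₀ ℕ) =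
        Finsupp.single j A.card := by rw [add_tsub_cancel_left, hm]
    rw [Finset.prod_insert hk, coeff_linear_mul, Finset.sum_insert hk, Finset.erase_insert hk, hs,
      Fintype.sum_eq_add i j hij]
    · rw [hi, coeff_prod_linear_pow]
      congr 1
      · simp
      · rcases m with _ | m
        · simp [Finset.card_eq_zero.1 hm, hij]
        · have hj : (Finsupp.single i 1 + Finsupp.single j (m + 1) - Finsupp.single j 1 :
              Fin l →₀ ℕ) = Finsupp.single i 1 + Finsupp.single j m := by
            rw [add_tsub_assoc_of_le (Finsupp.single_le_single.2 (Nat.le_add_left 1 m)),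
              ← Finsupp.single_tsub, Nat.add_sub_cancel]
          rw [hj, ih m hm]
          simp
    · rintro q ⟨hqi, hqj⟩
      simp [hqi, hqj]

theorem coeffB_eq (hn : 1 ≤ n) (a : Fin n → Fin l → ℕ) {i j : Fin l} (hij : i ≠ j) :
    coeffB a i j = ∑ k, a k i * ∏ k' ∈ Finset.univ.erase k, a k' j :=
  coeff_prod_linear a hij Finset.univ (n - 1) (by simp; omega)

theorem exists_unique_two {a : Fin n → Fin l → ℕ} (ha : ∀ k i, 1 ≤ a k i) {j : Fin l}
    (hj : ∑ k, a k j = n + 1) : ∃ k₀, a k₀ j = 2 ∧ ∀ k ≠ k₀, a k j = 1 := by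
  have hsum : ∑ k, (a k j - 1) = 1 := by
    have h1 : ∑ k, (a k j - 1) + ∑ _k : Fin n, 1 = ∑ k, a k j := by
      rw [← Finset.sum_add_distrib]
      exact Finset.sum_congr rfl fun k _ => Nat.sub_add_cancel (ha k j)
    rw [hj] at h1
    simp at h1
    omega
  obtain ⟨k₀, -, hk₀⟩ := Finset.exists_ne_zero_of_sum_ne_zero (hsum.trans_ne one_ne_zero)
  rw [← Finset.add_sum_erase _ _ (Finset.mem_univ k₀)] at hsum
  have h0 : ∑ k ∈ Finset.univ.erase k₀, (a k j - 1) = 0 := by omega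
  refine ⟨k₀, by omega, fun k hk => ?_⟩
  have := Finset.sum_eq_zero_iff.1 h0 k (Finset.mem_erase.2 ⟨hk, Finset.mem_univ k⟩)
  have := ha k j
  omega

/-- If the `j`-th degrees are all `1` except for a single `2`, then `b_ij` is, in terms of the
indicator `a_kj - 1` of the exceptional divisor, a simple bilinear expression. -/
theorem coeffB_cast (hn : 1 ≤ n) {a : Fin n → Fin l → ℕ} (ha : ∀ k i, 1 ≤ a k i) {i j : Fin l}
    (hij : i ≠ j) (hj : ∑ k, a k j = n + 1) :
    (coeffB a i j : ℝ) = 2 * (∑ k, (a k i : ℝ)) - ∑ k, (a k i : ℝ) * ((a k j : ℝ) - 1) := by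
  obtain ⟨k₀, hk₀, h1⟩ := exists_unique_two ha hj
  have hprod : ∀ k, ((∏ k' ∈ Finset.univ.erase k, a k' j : ℕ) : ℝ) = 2 - ((a k j : ℝ) - 1) := by
    intro k
    by_cases hk : k = k₀
    · subst hk
      rw [Finset.prod_eq_one fun q hq => h1 q (Finset.ne_of_mem_erase hq), hk₀]
      norm_num
    · rw [Finset.prod_eq_single k₀ (fun q _ hq => h1 q hq)
        (fun h => absurd (Finset.mem_erase.2 ⟨Ne.symm hk, Finset.mem_univ _⟩) h), hk₀, h1 k hk]
      norm_num
  rw [coeffB_eq hn a hij]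
  push_cast
  rw [Finset.mul_sum, ← Finset.sum_sub_distrib]
  refine Finset.sum_congr rfl fun k _ => ?_
  have := hprod k
  push_cast at this
  rw [this]
  ring

/-! ### The matrix `B` -/

theorem exists_neg_of_isLorentzian {B : Matrix (Fin l) (Fin l) ℝ} {J : Finset (Fin l)}
    (hL : IsLorentzian B J) : ∃ x : V l, ∑ i ∈ J, ∑ j ∈ J, x i * B i j * x j < 0 := by
  obtain ⟨-, h⟩ := hL
  obtain ⟨A, hA, hneg⟩ := exists_finrank_eq_sigNeg_and_negDef
    (Matrix.toBilin' (B.submatrix Subtype.val Subtype.val : Matrix J J ℝ)).toQuadraticMap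
  rw [h] at hA
  have : Nontrivial A := Module.nontrivial_of_finrank_pos (R := ℝ) (by omega)
  obtain ⟨x, hx⟩ := exists_ne (0 : A)
  have h1 := hneg x hx
  refine ⟨fun i => if h : i ∈ J then (x : J → ℝ) ⟨i, h⟩ else 0, ?_⟩
  rw [← Finset.sum_coe_sort J]
  simp_rw [← Finset.sum_coe_sort J (fun j => _ * _ * (if h : j ∈ J then (x : J → ℝ) ⟨j, h⟩ else 0))]
  simp only [QuadraticMap.restrict_apply, neg_apply,
    LinearMap.BilinMap.toQuadraticMap_apply, Matrix.toBilin'_apply, Matrix.submatrix_apply,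
    Left.neg_pos_iff] at h1
  simpa using h1

section Matrix

variable {N : Fin l → ℕ} {a : Fin n → Fin l → ℕ} {B : Matrix (Fin l) (Fin l) ℝ}
  {J : Finset (Fin l)}

theorem mem_minIndices {i : Fin l} : i ∈ minIndices N n ↔ N i = n := by
  simp [minIndices]

theorem ciMatrix_diag (i : Fin l) : ciMatrix N a i i = 1 := by simp [ciMatrix]

theorem ciMatrix_right {i j : Fin l} (hij : i ≠ j) (hj : j ∈ minIndices N n) :
    ciMatrix N a i j = -(coeffB a i j : ℝ) / 2 := by simp [ciMatrix, hij, hj]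

theorem ciMatrix_left {i j : Fin l} (hij : i ≠ j) (hi : i ∈ minIndices N n)
    (hj : j ∉ minIndices N n) : ciMatrix N a i j = -(coeffB a j i : ℝ) / 2 := by
  simp [ciMatrix, hij, hj, hi]

/-- The block of `B` with indices in `J`, as a multiple of the identity, minus a matrix of rank
one, plus a Gram matrix. -/
theorem ciMatrix_of_mem (hn : 1 ≤ n) (ha : ∀ k i, 1 ≤ a k i) (hsum : ∀ i, ∑ k, a k i = N i + 1)
    {i j : Fin l} (hi : i ∈ minIndices N n) (hj : j ∈ minIndices N n) :
    ciMatrix N a i j = (if i = j then (n + 1 : ℝ) else 0) - (n + 1 / 2) +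
      1 / 2 * ∑ k, ((a k i : ℝ) - 1) * ((a k j : ℝ) - 1) := by
  have hi' := mem_minIndices.1 hi ▸ hsum i
  have hj' := mem_minIndices.1 hj ▸ hsum j
  by_cases hij : i = j
  · subst hij
    obtain ⟨k₀, hk₀, h1⟩ := exists_unique_two ha hi'
    have h : ∑ k, ((a k i : ℝ) - 1) * ((a k i : ℝ) - 1) = 1 := by
      rw [Fintype.sum_eq_single k₀ fun k hk => by simp [h1 k hk], hk₀]
      norm_num
    rw [ciMatrix_diag, if_pos rfl, h]
    ring
  · have hcast : ∀ {i : Fin l}, ∑ k, a k i = n + 1 → ∑ k, (a k i : ℝ) = n + 1 := fun h => by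
      exact_mod_cast h
    have h : ∑ k, ((a k i : ℝ) - 1) * ((a k j : ℝ) - 1) =
        ∑ k, (a k i : ℝ) * ((a k j : ℝ) - 1) - (∑ k, (a k j : ℝ) - n) := by
      have : (n : ℝ) = ∑ _k : Fin n, (1 : ℝ) := by simp
      rw [this, ← Finset.sum_sub_distrib, ← Finset.sum_sub_distrib]
      exact Finset.sum_congr rfl fun k _ => by ring
    rw [ciMatrix_right hij hj, coeffB_cast hn ha hij hj', if_neg hij, h, hcast hi', hcast hj']
    ring

theorem ciMatrix_symm (hn : 1 ≤ n) (ha : ∀ k i, 1 ≤ a k i) (hsum : ∀ i, ∑ k, a k i = N i + 1)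
    (i j : Fin l) : ciMatrix N a i j = ciMatrix N a j i := by
  by_cases hij : i = j
  · rw [hij]
  by_cases hi : i ∈ minIndices N n
  · by_cases hj : j ∈ minIndices N n
    · rw [ciMatrix_of_mem hn ha hsum hi hj, ciMatrix_of_mem hn ha hsum hj hi]
      simp only [eq_comm (a := i), mul_comm]
    · rw [ciMatrix_left hij hi hj, ciMatrix_right (Ne.symm hij) hi]
  · by_cases hj : j ∈ minIndices N n
    · rw [ciMatrix_right hij hj, ciMatrix_left (Ne.symm hij) hj hi]
    · simp [ciMatrix, hi, hj, eq_comm (a := i)]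

theorem ciMatrix_le_of_mem (hn : 1 ≤ n) (ha : ∀ k i, 1 ≤ a k i)
    (hsum : ∀ i, ∑ k, a k i = N i + 1) {i j : Fin l} (hij : i ≠ j) (hi : i ∈ minIndices N n)
    (hj : j ∈ minIndices N n) : ciMatrix N a i j ≤ -n := by
  rw [ciMatrix_of_mem hn ha hsum hi hj, if_neg hij]
  obtain ⟨k₀, hk₀, h1⟩ := exists_unique_two ha (mem_minIndices.1 hj ▸ hsum j)
  obtain ⟨k₁, hk₁, h2⟩ := exists_unique_two ha (mem_minIndices.1 hi ▸ hsum i)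
  rw [Fintype.sum_eq_single k₀ fun k hk => by simp [h1 k hk], hk₀]
  have : (a k₀ i : ℝ) ≤ 2 := by
    by_cases h : k₀ = k₁
    · rw [h, hk₁]; norm_num
    · rw [h2 k₀ h]; norm_num
  push_cast
  linarith

theorem ciMatrix_eq_of_mem_of_one {a : Fin 1 → Fin l → ℕ} (ha : ∀ k i, 1 ≤ a k i)
    (hsum : ∀ i, ∑ k, a k i = N i + 1) {i j : Fin l} (hij : i ≠ j) (hi : i ∈ minIndices N 1)
    (hj : j ∈ minIndices N 1) : ciMatrix N a i j = -1 := by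
  have hi' := mem_minIndices.1 hi ▸ hsum i
  have hj' := mem_minIndices.1 hj ▸ hsum j
  rw [ciMatrix_of_mem le_rfl ha hsum hi hj, if_neg hij]
  simp only [Finset.univ_unique, Fin.default_eq_zero, Finset.sum_singleton] at hi' hj' ⊢
  rw [hi', hj']
  norm_num

theorem ciMatrix_le_neg_one (hN : ∀ i, 1 ≤ N i) (hn : IsLeast (Set.range N) n)
    (ha : ∀ k i, 1 ≤ a k i) (hsum : ∀ i, ∑ k, a k i = N i + 1) {i j : Fin l} (hij : i ≠ j) :
    ciMatrix N a i j ≤ -1 := by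
  have hn1 : 1 ≤ n := by
    obtain ⟨i, hi⟩ := hn.1
    exact hi ▸ hN i
  have hn1' : (1 : ℝ) ≤ n := by exact_mod_cast hn1
  have mixed : ∀ {i j : Fin l}, i ≠ j → j ∈ minIndices N n → ciMatrix N a i j ≤ -1 := by
    intro i j hij hj
    obtain ⟨k₀, hk₀, h1⟩ := exists_unique_two ha (mem_minIndices.1 hj ▸ hsum j)
    have h2 : (a k₀ i : ℝ) ≤ N i + 1 := by
      exact_mod_cast (Finset.single_le_sum (f := fun k => a k i) (fun _ _ => Nat.zero_le _)
        (Finset.mem_univ k₀)).trans (hsum i).le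
    have h3 : ∑ k, (a k i : ℝ) = N i + 1 := by exact_mod_cast hsum i
    have h4 : (1 : ℝ) ≤ N i := by exact_mod_cast hN i
    rw [ciMatrix_right hij hj, coeffB_cast hn1 ha hij (mem_minIndices.1 hj ▸ hsum j), h3,
      Fintype.sum_eq_single k₀ fun k hk => by simp [h1 k hk], hk₀]
    push_cast
    linarith
  by_cases hj : j ∈ minIndices N n
  · exact mixed hij hj
  · by_cases hi : i ∈ minIndices N n
    · rw [ciMatrix_symm hn1 ha hsum]
      exact mixed hij.symm hi
    · have : ∀ m, (1 : ℝ) ≤ N m := fun m => by exact_mod_cast hN m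
      simp only [ciMatrix, Matrix.of_apply, hij, hi, hj, if_false]
      exact neg_le_neg (this _)

theorem exists_int_ciMatrix (i j : Fin l) : ∃ z : ℤ, 2 * ciMatrix N a i j = z := by
  simp only [ciMatrix, Matrix.of_apply]
  split_ifs
  · exact ⟨2, by norm_num⟩
  · exact ⟨-(coeffB a i j : ℤ), by push_cast; ring⟩
  · exact ⟨-(coeffB a j i : ℤ), by push_cast; ring⟩
  · exact ⟨-2 * (N ⟨l - 1, _⟩ : ℤ), by push_cast; ring⟩

theorem ciMatrix_pos (hn : 1 ≤ n) (ha : ∀ k i, 1 ≤ a k i) (hsum : ∀ i, ∑ k, a k i = N i + 1)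
    {x : V l} (hx : ∀ i ∉ minIndices N n, x i = 0) (hx0 : ∑ i, x i = 0)
    (h : x ⬝ᵥ (ciMatrix N a).mulVec x ≤ 0) : x = 0 := by
  have key : x ⬝ᵥ (ciMatrix N a).mulVec x = (n + 1) * ∑ i, x i ^ 2 - (n + 1 / 2) * (∑ i, x i) ^ 2 +
      1 / 2 * ∑ k, (∑ i, ((a k i : ℝ) - 1) * x i) ^ 2 := by
    have h1 : x ⬝ᵥ (ciMatrix N a).mulVec x = ∑ i, ∑ j, ((n + 1) * (if i = j then x i * x j else 0) -
        (n + 1 / 2) * (x i * x j) +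
        1 / 2 * ∑ k, (((a k i : ℝ) - 1) * x i) * (((a k j : ℝ) - 1) * x j)) := by
      simp only [dotProduct, Matrix.mulVec, Finset.mul_sum]
      refine Finset.sum_congr rfl fun i _ => Finset.sum_congr rfl fun j _ => ?_
      by_cases hi : i ∈ minIndices N n
      · by_cases hj : j ∈ minIndices N n
        · rw [ciMatrix_of_mem hn ha hsum hi hj, add_mul, mul_add, Finset.mul_sum, Finset.sum_mul,
            Finset.mul_sum]
          congr 1
          · split_ifs <;> ring
          · exact Finset.sum_congr rfl fun k _ => by ring
        · simp [hx j hj]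
      · simp [hx i hi]
    rw [h1]
    simp only [Finset.sum_add_distrib, Finset.sum_sub_distrib, ← Finset.mul_sum,
      Finset.sum_ite_eq, Finset.mem_univ, if_true, pow_two, Finset.sum_mul_sum]
    congr 2
    refine ((Finset.sum_congr rfl fun i _ => Finset.sum_comm).trans Finset.sum_comm).trans ?_
    exact Finset.sum_congr rfl fun k _ => Finset.sum_congr rfl fun i _ => (Finset.mul_sum ..).symm
  rw [key, hx0] at h
  have h2 : 0 ≤ ∑ k, (∑ i, ((a k i : ℝ) - 1) * x i) ^ 2 := Finset.sum_nonneg fun _ _ => sq_nonneg _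
  have h3 : 0 ≤ ∑ i, x i ^ 2 := Finset.sum_nonneg fun _ _ => sq_nonneg _
  have h4 : ∑ i, x i ^ 2 = 0 := by
    have : (0 : ℝ) ≤ n := Nat.cast_nonneg n
    nlinarith
  ext i
  exact pow_eq_zero_iff (two_ne_zero) |>.1
    ((Finset.sum_eq_zero_iff_of_nonneg fun _ _ => sq_nonneg _).1 h4 i (Finset.mem_univ i))

/-- The Lorentzian hypothesis only excludes `|J| ≤ 1` and, for `n = 1`, the degenerate case
`|J| = 2`; otherwise the explicit shape of `B` makes it Lorentzian. -/
theorem isLorentzianDatum_ciMatrix (hN : ∀ i, 1 ≤ N i) (hn : IsLeast (Set.range N) n)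
    (ha : ∀ k i, 1 ≤ a k i) (hsum : ∀ i, ∑ k, a k i = N i + 1)
    (hL : IsLorentzian (ciMatrix N a) (minIndices N n)) :
    IsLorentzianDatum (ciMatrix N a) (minIndices N n) := by
  have hn1 : 1 ≤ n := by
    obtain ⟨i, hi⟩ := hn.1
    exact hi ▸ hN i
  obtain ⟨x, hx⟩ := exists_neg_of_isLorentzian hL
  have hcard : 2 ≤ (minIndices N n).card ∧ (n = 1 → 3 ≤ (minIndices N n).card) := by
    have h2 : 2 ≤ (minIndices N n).card := by
      by_contra! hc
      rcases Nat.le_one_iff_eq_zero_or_eq_one.1 (Nat.le_of_lt_succ hc) with h | h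
      · rw [Finset.card_eq_zero.1 h] at hx
        simp at hx
      · obtain ⟨i, hi⟩ := Finset.card_eq_one.1 h
        rw [hi] at hx
        simp only [Finset.sum_singleton, ciMatrix_diag] at hx
        nlinarith [mul_self_nonneg (x i)]
    refine ⟨h2, fun h1 => ?_⟩
    subst h1
    by_contra! hc
    obtain ⟨i, j, hij, h⟩ := Finset.card_eq_two.1 (show (minIndices N 1).card = 2 by omega)
    have e1 := ciMatrix_eq_of_mem_of_one ha hsum hij (by simp [h]) (by simp [h])
    have e2 := ciMatrix_eq_of_mem_of_one ha hsum hij.symm (by simp [h]) (by simp [h])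
    rw [h, Finset.sum_pair hij, Finset.sum_pair hij, Finset.sum_pair hij, e1, e2, ciMatrix_diag,
      ciMatrix_diag] at hx
    nlinarith [sq_nonneg (x i - x j)]
  refine ⟨ciMatrix_symm hn1 ha hsum, ciMatrix_diag,
    fun i j hij => ciMatrix_le_neg_one hN hn ha hsum hij, exists_int_ciMatrix,
    fun x hx hx0 h => ciMatrix_pos hn1 ha hsum hx hx0 h, fun j hj => ?_,
    Finset.card_pos.1 (by omega)⟩
  rw [← Finset.add_sum_erase _ _ hj, ciMatrix_diag]
  have h1 : ∑ k ∈ (minIndices N n).erase j, ciMatrix N a j k ≤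
      ∑ k ∈ (minIndices N n).erase j, -(n : ℝ) := Finset.sum_le_sum fun k hk =>
    ciMatrix_le_of_mem hn1 ha hsum (Finset.ne_of_mem_erase hk).symm hj (Finset.mem_of_mem_erase hk)
  rw [Finset.sum_const, nsmul_eq_mul] at h1
  have h2 : 2 ≤ ((minIndices N n).erase j).card * n := by
    rw [Finset.card_erase_of_mem hj]
    rcases hn1.eq_or_lt with h | h
    · have := hcard.2 h.symm
      exact (by omega : 2 ≤ (minIndices N n).card - 1).trans (Nat.le_mul_of_pos_right _ hn1)
    · have : 1 ≤ (minIndices N n).card - 1 := by omega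
      nlinarith
  have h3 : (2 : ℝ) ≤ (((minIndices N n).erase j).card : ℝ) * n := by exact_mod_cast h2
  linarith

end Matrix

end Degrees

end MovCone

open MovCone in
theorem theorem4p9 (l n : ℕ) (N : Fin l → ℕ) (hN : ∀ i, 1 ≤ N i)
    (hn : IsLeast (Set.range N) n)
    (a : Fin n → Fin l → ℕ) (ha : ∀ k i, 1 ≤ a k i) (hsum : ∀ i, ∑ k, a k i = N i + 1)
    (J : Finset (Fin l)) (hJ : J = minIndices N n)
    (B : Matrix (Fin l) (Fin l) ℝ) (hB : B = ciMatrix N a)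
    (hL : IsLorentzian B J) :
    -- the statement for the Tits cone in the dual space `V^*`
    ((2 ≤ n → ∀ i ∈ J, ∀ j ∈ J, i ≠ j →
        (∃! lam : ℝ, 1 < lam ∧ Module.End.HasEigenvalue ((geomRep B).dual (s i * s j)) lam) ∧
        ∃ v, IsExpandingVector (geomRep B).dual
          (orbit (geomRep B).dual J (dualChamber l)) i j v) ∧
      ∀ v : Fin l → Fin l → Module.Dual ℝ (V l),
        (2 ≤ n → ∀ i ∈ J, ∀ j ∈ J, i ≠ j → IsExpandingVector (geomRep B).dual
          (orbit (geomRep B).dual J (dualChamber l)) i j (v i j)) →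
        (n = 1 → ∀ i ∈ J, ∀ j ∈ J, i ≠ j → v i j = 0) →
        frontier (closure (orbit (geomRep B).dual J (dualChamber l))) =
          closure ((⋃ i ∉ J, orbit (geomRep B).dual J (face dualRoot i)) ∪
            ⋃ i ∈ J, ⋃ j ∈ J, ⋃ _ : i ≠ j,
              orbit (geomRep B).dual J (cone dualRoot i j (v i j)))) ∧
    -- the same statement in `V`, whenever the vectors `c_i` exist there
    ∀ c : Fin l → V l, (∀ i j, form B (c i) (simpleRoot j) = if i = j then 1 else 0) →
      (2 ≤ n → ∀ i ∈ J, ∀ j ∈ J, i ≠ j →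
        (∃! lam : ℝ, 1 < lam ∧ Module.End.HasEigenvalue (geomRep B (s i * s j)) lam) ∧
        ∃ v, IsExpandingVector (geomRep B) (orbit (geomRep B) J (chamber B)) i j v) ∧
      ∀ v : Fin l → Fin l → V l,
        (2 ≤ n → ∀ i ∈ J, ∀ j ∈ J, i ≠ j → IsExpandingVector (geomRep B)
          (orbit (geomRep B) J (chamber B)) i j (v i j)) →
        (n = 1 → ∀ i ∈ J, ∀ j ∈ J, i ≠ j → v i j = 0) →
        frontier (closure (orbit (geomRep B) J (chamber B))) =
          closure ((⋃ i ∉ J, orbit (geomRep B) J (face c i)) ∪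
            ⋃ i ∈ J, ⋃ j ∈ J, ⋃ _ : i ≠ j, orbit (geomRep B) J (cone c i j (v i j))) := by

  subst hJ hB
  have hB := isLorentzianDatum_ciMatrix hN hn ha hsum hL
  have hn1 : 1 ≤ n := by
    obtain ⟨i, hi⟩ := hn.1
    exact hi ▸ hN i
  have h2 : 2 ≤ n → ∀ i ∈ minIndices N n, ∀ j ∈ minIndices N n, i ≠ j →
      ciMatrix N a i j < -1 := fun h i hi j hj hij => by
    have h1 := ciMatrix_le_of_mem hn1 ha hsum hij hi hj
    have : (2 : ℝ) ≤ n := by exact_mod_cast h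
    linarith
  have h1 : n = 1 → ∀ i ∈ minIndices N n, ∀ j ∈ minIndices N n, i ≠ j →
      ciMatrix N a i j = -1 := fun h i hi j hj hij => by
    subst h
    exact ciMatrix_eq_of_mem_of_one ha hsum hij hi hj
  refine ⟨?_, fun c hc => ?_⟩
  · exact hB.boundary_dual hn1 h2 h1
  · exact hB.boundary_of_dualBasis hn1 h2 h1 hc
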